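/- Decoupled bandit with $K\ge 2$ arms and horizon $T$. In each round $t=1,\dots,T$ an adaptive (possibly randomized) environment fixes a loss vector $\ell_t\in[0,1]^K$; the learner exploits an arm $i_t$ (suffering $\ell_{t,i_t}$ without observing it) and explores an arm $j_t$ (observing $\ell_{t,j_t}$ without suffering it). The pseudo-regret is $$\mathrm{Reg}(T)=\mathbb E\Big[\sum_{t=1}^T\ell_{t,i_t}\Big]-\min_{i\in[K]}\mathbb E\Big[\sum_{t=1}^T\ell_{t,i}\Big].$$ *Algorithm.* Given a shape $\alpha>1$ and learning rates $\eta_t>0$, set $\hat L_1=\mathbf 0$. In round $t$: draw $r_{t,1},\dots,r_{t,K}$ afresh, i.i.d. from the Pareto distribution with density $\alpha x^{-\alpha-1}$ on $[1,\infty)$; exploit $i_t\in\arg\min_{i}\{\hat L_{t,i}-r_{t,i}/\eta_t\}$; explore $j_t\sim p_t$, where $$p_{t,i}=\frac{q_{t,i}}{\sum_{k}q_{t,k}},\qquad q_{t,i}=\Big(\frac{1}{1+\eta_t(\hat L_{t,i}-\min_k\hat L_{t,k})}\wedge\frac1{\sigma_{t,i}^{1/\alpha}}\Big)^{\frac{\alpha+1}2},$$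 and $\sigma_{t,i}\in\{1,\dots,K\}$ is the rank of $\hat L_{t,i}$ among $\hat L_{t,1},\dots,\hat L_{t,K}$ in increasing order (ties broken arbitrarily); then put $\hat L_{t+1}=\hat L_t+\ell_{t,j_t}p_{t,j_t}^{-1}e_{j_t}$. *Stochastically constrained adversarial regime with a unique best arm.* The environment may react to the past, but there are fixed numbers $\Delta_{i,k}$ such that, conditionally on the history before round $t$, $\mathbb E[\ell_{t,i}-\ell_{t,k}]=\Delta_{i,k}$ for all $i,k,t$; and there is an arm $i^*$ with $\Delta_i:=\Delta_{i,i^*}>0$ for all $i\ne i^*$. Let $\Delta_{\min}=\min_{i\ne i^*}\Delta_i$. *Claim.* For every $c>0$ there is a constant $C>0$ depending only on $c$ such that, for all $K\ge2$ and all $T$, in every such environment the algorithm with $\alpha=3$ and $\eta_t=cK^{\frac1\alpha-\frac12}/\sqrt t$ satisfies $$\mathrm{Reg}(T)\le C\left(\sqrt{\frac{K}{\Delta_{\min}}\sum_{i\ne i^*}\frac1{\Delta_i}}+\frac{K}{\Delta_{\min}}\right).$$ -/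

import Mathlib

open MeasureTheory ProbabilityTheory

/-!  Rounds are indexed from `0`: index `t` is the round usually numbered `t + 1`, and a run of
horizon `T` consists of the rounds `t < T`.  Arms are the elements of `Fin K`. -/

noncomputable section

namespace DecoupledBandit

variable {K : ℕ}

/-- The loss gap `L i - min_j L j` of arm `i`. -/
def lossGap (L : Fin K → ℝ) (i : Fin K) : ℝ := L i - ⨅ j, L j

/-- `σ` ranks the arms by increasing value of `L`, ties being broken in any way: the rank of arm
`i`, in `{1, …, K}`, is `σ i + 1`. -/
def IsRanking (L : Fin K → ℝ) (σ : Equiv.Perm (Fin K)) : Prop :=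
  ∀ i j, L i < L j → σ i < σ j

/-- The unnormalized exploration weight
`q i = ((1 / (1 + η * gap i)) ∧ (1 / rank i ^ (1 / α))) ^ ((α + 1) / 2)`. -/
def exploreWeight (α η : ℝ) (L : Fin K → ℝ) (σ : Equiv.Perm (Fin K)) (i : Fin K) : ℝ :=
  (min (1 / (1 + η * lossGap L i)) (1 / (((σ i : ℕ) + 1 : ℝ) ^ (1 / α)))) ^ ((α + 1) / 2)

/-- The exploration probability `p i = q i / ∑ j, q j`. -/
def exploreProb (α η : ℝ) (L : Fin K → ℝ) (σ : Equiv.Perm (Fin K)) (i : Fin K) : ℝ :=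
  exploreWeight α η L σ i / ∑ k, exploreWeight α η L σ k

/-- The estimated cumulative losses at the beginning of round `t`, from the learning rates `η`, the
losses `ℓ`, the rankings `σ` and the explored arms `j`: they start at zero, and each round adds
the importance-weighted observed loss of the explored arm. -/
def estLoss (α : ℝ) (η : ℕ → ℝ) (ℓ : ℕ → Fin K → ℝ) (σ : ℕ → Equiv.Perm (Fin K))
    (j : ℕ → Fin K) : ℕ → Fin K → ℝ
  | 0 => 0
  | t + 1 => estLoss α η ℓ σ j t +
      Pi.single (j t) (ℓ t (j t) / exploreProb α (η t) (estLoss α η ℓ σ j t) (σ t) (j t))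

/-- The learning rate `c * K ^ (1 / α - 1 / 2) / √t` of the `t`-th round, counted from one. -/
def learningRate (α c : ℝ) (K : ℕ) (t : ℕ) : ℝ :=
  c * (K : ℝ) ^ (1 / α - 1 / 2) / √((t : ℝ) + 1)

variable {Ω : Type*} [m : MeasurableSpace Ω]

/-- A run over `T` rounds of follow-the-perturbed-leader with Pareto perturbations for decoupled
exploration and exploitation.  `ℱ t` is the history at the beginning of round `t`; `ℓ` are the
losses, `r` the perturbations, `σ` the rankings of the estimated losses, `i` the exploited arms
and `j` the explored arms.  The losses of a round may depend in any way on the history, but they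
are fixed before the learner draws the randomness of that round. -/
structure IsRun (μ : Measure Ω) (α : ℝ) (η : ℕ → ℝ) (T : ℕ) (ℱ : Filtration ℕ m)
    (ℓ r : ℕ → Ω → Fin K → ℝ) (σ : ℕ → Ω → Equiv.Perm (Fin K)) (i j : ℕ → Ω → Fin K) :
    Prop where
  /-- The losses, perturbations and arms of the earlier rounds belong to the history. -/
  measurable_loss : ∀ t < T, Measurable[ℱ (t + 1)] (ℓ t)
  measurable_perturbation : ∀ t < T, Measurable[ℱ (t + 1)] (r t)
  measurable_exploit : ∀ t < T, Measurable[ℱ (t + 1)] (i t)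
  measurable_explore : ∀ t < T, Measurable[ℱ (t + 1)] (j t)
  /-- The rankings are determined at the beginning of the round, with any tie-breaking. -/
  measurable_rank : ∀ t < T, ∀ k, Measurable[ℱ t] (fun ω => σ t ω k)
  rank : ∀ t < T, ∀ ω,
    IsRanking (estLoss α η (fun s => ℓ s ω) (fun s => σ s ω) (fun s => j s ω) t) (σ t ω)
  /-- The perturbations are drawn afresh, i.i.d. over the arms from the Pareto distribution with
  scale `1` and shape `α`. -/
  perturbation_law : ∀ t < T, μ.map (r t) = Measure.pi (fun _ => paretoMeasure 1 α)
  perturbation_indep : ∀ t < T,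
    Indep (MeasurableSpace.comap (r t) inferInstance)
      (ℱ t ⊔ MeasurableSpace.comap (ℓ t) inferInstance) μ
  /-- The exploited arm minimizes the perturbed estimated cumulative loss. -/
  exploit : ∀ t < T, ∀ ω k,
    estLoss α η (fun s => ℓ s ω) (fun s => σ s ω) (fun s => j s ω) t (i t ω) -
        r t ω (i t ω) / η t ≤
      estLoss α η (fun s => ℓ s ω) (fun s => σ s ω) (fun s => j s ω) t k - r t ω k / η t
  /-- The explored arm is drawn from the exploration distribution, given the history, the losses
  and the perturbations. -/
  explore : ∀ t < T, ∀ k,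
    μ[{ω | j t ω = k}.indicator (fun _ => (1 : ℝ)) |
        ℱ t ⊔ MeasurableSpace.comap (ℓ t) inferInstance ⊔
          MeasurableSpace.comap (r t) inferInstance]
      =ᵐ[μ] fun ω => exploreProb α (η t)
        (estLoss α η (fun s => ℓ s ω) (fun s => σ s ω) (fun s => j s ω) t) (σ t ω) k

/-- The stochastically constrained adversarial regime with respect to the history `ℱ`: the losses
lie in `[0, 1]`, and whatever happened before, the conditional expected loss of arm `k` in a round
exceeds that of arm `k'` by the fixed amount `Δ k k'`. -/
structure IsSCA (μ : Measure Ω) (T : ℕ) (ℱ : Filtration ℕ m) (ℓ : ℕ → Ω → Fin K → ℝ)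
    (Δ : Fin K → Fin K → ℝ) : Prop where
  loss_mem : ∀ t < T, ∀ ω k, ℓ t ω k ∈ Set.Icc (0 : ℝ) 1
  gap : ∀ t < T, ∀ k k',
    μ[fun ω => ℓ t ω k - ℓ t ω k' | ℱ t] =ᵐ[μ] fun _ => Δ k k'

/-- The pseudo-regret over `T` rounds of the exploited arms `i`. -/
def pseudoRegret (μ : Measure Ω) (T : ℕ) (ℓ : ℕ → Ω → Fin K → ℝ) (i : ℕ → Ω → Fin K) : ℝ :=
  (∫ ω, ∑ t ∈ Finset.range T, ℓ t ω (i t ω) ∂μ) -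
    ⨅ k, ∫ ω, ∑ t ∈ Finset.range T, ℓ t ω k ∂μ

/-- The smallest suboptimality gap `min_{k ≠ k₀} Δ k k₀`. -/
def minGap (Δ : Fin K → Fin K → ℝ) (k₀ : Fin K) : ℝ := ⨅ k : {k : Fin K // k ≠ k₀}, Δ k k₀

end DecoupledBandit

end

/-! Put g = η·(L − min L), so that, given the past, arm k is exploited with probability `winProb g
k`. Let b be the best arm and X_t the probability that round t exploits another arm.

The regret is split by the potential E min_i (L_i − (ρ_i − ρ_b)/η). It never exceeds L_b, whose mean
is the cumulative loss of b (`integral_runLoss`). Each round it grows at least by the loss estimate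
times the winning probability after the update (`mul_winProb_le_potential_sub`). A decrease of η
costs nothing where b wins, and the rest is a multiple of X_t plus a Pareto tail
(`potential_sub_le`). Hence regret is at most stability plus penalty (`sum_integral_sub_le`).

For the stability, raising one coordinate by δ costs that arm O(δ·score⁴) of winning probability,
because the Pareto density is 3x⁻⁴ (`winProb_sub_le_score`). Exploring in proportion to score² makes
δ = O(η K^(1/3)/score²), so each arm costs O(η K^(1/3) score²). To bring in X_t, use score² ≤
a·score³ + 1/a²: the sum of (1 + g_k)⁻³ over k ≠ b is O(1 − `winProb g b`) when that quantity is
small (`min_one_mass_le`). The leader itself needs the separate estimate `winProb_sub_le_leader`.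
The outcome is `stability_le_self_bounding`, of the same form a·X + K/a² as the penalty.

The regret is also at least Δ_min ∑ X_t. With κ = K^(1/6) and u = √t, a round costs O((κ/u)(a X_t +
κ⁶/a²)). Taking a of order Δ_min u/κ turns the first term into Δ_min X_t/2, which is absorbed, and
leaves O(κ⁹/(Δ_min² u³)). Before u ≈ κ³/Δ_min the crude bound O(κ³/u) is used. Both phases sum to
O(κ⁶/Δ_min) = O(K/Δ_min), so the square-root term, never larger than K/Δ_min, is not needed. -/

noncomputable section

namespace DecoupledBandit

/-! ### The Pareto law of shape 3 and its products -/

section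

/-- The Pareto distribution with scale `1` and shape `3`. -/
abbrev pareto3 : Measure ℝ := paretoMeasure 1 3

instance : IsProbabilityMeasure pareto3 :=
  isProbabilityMeasure_paretoMeasure one_pos three_pos

instance : NullSingletonClass pareto3 := by unfold pareto3 paretoMeasure; infer_instance

/-- The joint law of `K` independent perturbations. -/
abbrev perturbLaw (K : ℕ) : Measure (Fin K → ℝ) := Measure.pi fun _ => pareto3

lemma paretoPDFReal_of_one_le {x : ℝ} (hx : 1 ≤ x) :
    paretoPDFReal 1 3 x = 3 * x ^ (-4 : ℝ) := by
  rw [paretoPDFReal, if_pos hx]; norm_num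

lemma pareto3_real_eq_integral {s : Set ℝ} (hs : MeasurableSet s) :
    pareto3.real s = ∫ x in s, paretoPDFReal 1 3 x := by
  rw [measureReal_def, pareto3, paretoMeasure, withDensity_apply _ hs,
    integral_eq_lintegral_of_nonneg_ae]
  · rfl
  · exact ae_of_all _ fun x => paretoPDFReal_nonneg zero_le_one zero_le_three x
  · fun_prop

lemma ae_pareto3_one_le : ∀ᵐ x ∂pareto3, 1 ≤ x := by
  rw [ae_iff]
  have : {a : ℝ | ¬ 1 ≤ a} = Set.Iio 1 := by ext; simp
  rw [this, pareto3, paretoMeasure, withDensity_apply _ measurableSet_Iio]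
  exact lintegral_paretoPDF_of_le le_rfl

lemma pareto3_real_Ici_of_one_le {z : ℝ} (hz : 1 ≤ z) :
    pareto3.real (Set.Ici z) = (z ^ 3)⁻¹ := by
  have hz0 : 0 < z := by linarith
  rw [pareto3_real_eq_integral measurableSet_Ici,
    setIntegral_congr_fun (g := fun x => 3 * x ^ (-4 : ℝ)) measurableSet_Ici
      (fun x hx => paretoPDFReal_of_one_le (hz.trans hx)),
    integral_Ici_eq_integral_Ioi, integral_const_mul,
    integral_Ioi_rpow_of_lt (by norm_num) hz0]
  have : z ^ (-4 + 1 : ℝ) = (z ^ 3)⁻¹ := by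
    rw [show (-4 + 1 : ℝ) = -((3 : ℕ) : ℝ) by norm_num, Real.rpow_neg hz0.le, Real.rpow_natCast]
  rw [this]; ring

lemma pareto3_real_Ici (z : ℝ) : pareto3.real (Set.Ici z) = (max 1 z ^ 3)⁻¹ := by
  rcases le_total 1 z with h | h
  · rw [max_eq_right h, pareto3_real_Ici_of_one_le h]
  · rw [max_eq_left h]
    have : pareto3 (Set.Ici z) = 1 := by
      rw [prob_compl_eq_zero_iff measurableSet_Ici |>.symm]
      filter_upwards [ae_pareto3_one_le] with x hx using h.trans hx
    simp [measureReal_def, this]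

/-- The density vanishes below 1 and decreases above it, so on the interval it is at most its value
at `max 1 z`. -/
lemma pareto3_real_Ico_le (z : ℝ) {δ : ℝ} (hδ : 0 ≤ δ) :
    pareto3.real (Set.Ico z (z + δ)) ≤ 3 * δ * (max 1 z ^ 4)⁻¹ := by
  have hm : 0 < max 1 z := lt_max_of_lt_left one_pos
  have h1 : ∀ x ∈ Set.Ico z (z + δ), paretoPDFReal 1 3 x ≤ 3 * (max 1 z ^ 4)⁻¹ := by
    intro x hx
    rcases lt_or_ge x 1 with h | h
    · rw [paretoPDFReal, if_neg (not_le.2 h)]; positivity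
    · rw [paretoPDFReal_of_one_le h, show (-4 : ℝ) = -((4 : ℕ) : ℝ) by norm_num,
        Real.rpow_neg (by linarith), Real.rpow_natCast]
      have : max 1 z ≤ x := max_le h hx.1
      gcongr
  have hint : IntegrableOn (fun _ : ℝ => 3 * (max 1 z ^ 4)⁻¹) (Set.Ico z (z + δ)) :=
    integrableOn_const (by simp)
  rw [pareto3_real_eq_integral measurableSet_Ico]
  calc _ ≤ ∫ x in Set.Ico z (z + δ), 3 * (max 1 z ^ 4)⁻¹ := by
        refine setIntegral_mono_on ?_ hint measurableSet_Ico h1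
        refine Integrable.mono' hint (by fun_prop) ?_
        refine (ae_restrict_iff' measurableSet_Ico).2 (ae_of_all _ fun x hx => ?_)
        rw [Real.norm_of_nonneg (paretoPDFReal_nonneg zero_le_one zero_le_three x)]
        exact h1 x hx
    _ = 3 * δ * (max 1 z ^ 4)⁻¹ := by
        simp [hδ]; ring

lemma integral_pareto3_eq (g : ℝ → ℝ) :
    ∫ x, g x ∂pareto3 = ∫ x, paretoPDFReal 1 3 x * g x := by
  have : pareto3 = volume.withDensity (fun x => ENNReal.ofReal (paretoPDFReal 1 3 x)) := rfl
  rw [this, integral_withDensity_eq_integral_toReal_smul (by fun_prop) (by simp)]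
  congr 1; ext x
  rw [ENNReal.toReal_ofReal (paretoPDFReal_nonneg zero_le_one zero_le_three x), smul_eq_mul]

lemma paretoPDFReal_mul_indicator {M : ℝ} (hM : 1 ≤ M) (x : ℝ) :
    paretoPDFReal 1 3 x * (Set.Ioi M).indicator id x =
      (Set.Ioi M).indicator (fun x => 3 * x ^ (-3 : ℝ)) x := by
  by_cases hx : x ∈ Set.Ioi M
  · have hx1 : 1 ≤ x := hM.trans (le_of_lt hx)
    rw [Set.indicator_of_mem hx, Set.indicator_of_mem hx, paretoPDFReal_of_one_le hx1, id,
      mul_assoc, ← Real.rpow_add_one (by linarith)]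
    norm_num
  · simp [hx]

lemma integrable_indicator_pareto3 {M : ℝ} (hM : 1 ≤ M) :
    Integrable ((Set.Ioi M).indicator id) pareto3 := by
  have : pareto3 = volume.withDensity (fun x => ENNReal.ofReal (paretoPDFReal 1 3 x)) := rfl
  rw [this, integrable_withDensity_iff_integrable_smul' (by fun_prop) (by simp)]
  have : Integrable ((Set.Ioi M).indicator (fun x : ℝ => 3 * x ^ (-3 : ℝ))) :=
    (integrable_indicator_iff measurableSet_Ioi).2
      ((integrableOn_Ioi_rpow_of_lt (by norm_num) (by linarith)).const_mul _)
  refine this.congr (ae_of_all _ fun x => ?_)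
  simp only [ENNReal.toReal_ofReal (paretoPDFReal_nonneg zero_le_one zero_le_three x), smul_eq_mul]
  exact (paretoPDFReal_mul_indicator hM x).symm

lemma integral_indicator_pareto3 {M : ℝ} (hM : 1 ≤ M) :
    ∫ x, (Set.Ioi M).indicator id x ∂pareto3 = 3 / 2 * (M ^ 2)⁻¹ := by
  have hM0 : 0 < M := by linarith
  simp_rw [integral_pareto3_eq, paretoPDFReal_mul_indicator hM]
  rw [integral_indicator measurableSet_Ioi, integral_const_mul,
    integral_Ioi_rpow_of_lt (by norm_num) hM0]
  have : M ^ (-3 + 1 : ℝ) = (M ^ 2)⁻¹ := by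
    rw [show (-3 + 1 : ℝ) = -((2 : ℕ) : ℝ) by norm_num, Real.rpow_neg hM0.le, Real.rpow_natCast]
  rw [this]; ring

lemma integrable_id_pareto3 : Integrable (fun x : ℝ => x) pareto3 := by
  refine ((integrable_const (1 : ℝ)).add (integrable_indicator_pareto3 le_rfl)).mono'
    (by fun_prop) ?_
  filter_upwards [ae_pareto3_one_le] with x hx
  rw [Real.norm_of_nonneg (by linarith)]
  by_cases h : x ∈ Set.Ioi 1
  · simp [h]
  · simp only [Set.mem_Ioi, not_lt] at h
    simp [h.not_gt]; linarith

variable {K : ℕ}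

lemma ae_perturbLaw_one_le : ∀ᵐ x ∂perturbLaw K, ∀ k, 1 ≤ x k := by
  rw [ae_all_iff]
  intro k
  exact (measurePreserving_eval (fun _ : Fin K => pareto3) k).quasiMeasurePreserving.ae
    ae_pareto3_one_le

lemma perturbLaw_real_eval (k : Fin K) {s : Set ℝ} (hs : MeasurableSet s) :
    (perturbLaw K).real {x | x k ∈ s} = pareto3.real s := by
  rw [measureReal_def, measureReal_def,
    ← (measurePreserving_eval (fun _ : Fin K => pareto3) k).measure_preimage hs.nullMeasurableSet]
  rfl

lemma integrable_comp_eval {g : ℝ → ℝ} (hg : Integrable g pareto3) (k : Fin K) :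
    Integrable (fun x => g (x k)) (perturbLaw K) :=
  (measurePreserving_eval (fun _ : Fin K => pareto3) k).integrable_comp_of_integrable hg

lemma integral_comp_eval {g : ℝ → ℝ} (hg : AEStronglyMeasurable g pareto3) (k : Fin K) :
    ∫ x, g (x k) ∂perturbLaw K = ∫ y, g y ∂pareto3 := by
  have h := measurePreserving_eval (fun _ : Fin K => pareto3) k
  rw [← h.map_eq, integral_map h.measurable.aemeasurable (by rwa [h.map_eq])]

lemma measurable_update_pair (k : Fin K) :
    Measurable fun p : (Fin K → ℝ) × ℝ => Function.update p.1 k p.2 :=  by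
  rw [measurable_pi_iff]
  intro j
  by_cases h : j = k
  · subst h; simpa using measurable_snd
  · simp only [ne_eq, h, not_false_eq_true, Function.update_of_ne]; fun_prop

/-- Overwriting one coordinate by a fresh copy gives a form of Fubini that never splits the product
space. -/
lemma map_update_perturbLaw (k : Fin K) :
    ((perturbLaw K).prod pareto3).map (fun p => Function.update p.1 k p.2) = perturbLaw K := by
  refine (Measure.pi_eq fun s hs => ?_).symm
  rw [Measure.map_apply (measurable_update_pair k) (MeasurableSet.univ_pi hs)]
  have : (fun p : (Fin K → ℝ) × ℝ => Function.update p.1 k p.2) ⁻¹' Set.univ.pi s =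
      (Set.univ.pi (Function.update s k Set.univ)) ×ˢ s k := by
    ext ⟨x, y⟩
    simp only [Set.mem_preimage, Set.mem_univ_pi, Set.mem_prod]
    constructor
    · intro h
      refine ⟨fun j => ?_, by simpa using h k⟩
      by_cases hj : j = k
      · subst hj; simp
      · simpa [hj] using h j
    · rintro ⟨h1, h2⟩ j
      by_cases hj : j = k
      · subst hj; simpa using h2
      · simpa [hj] using h1 j
  rw [this, Measure.prod_prod, Measure.pi_pi,
    ← Finset.mul_prod_erase _ _ (Finset.mem_univ k),
    ← Finset.mul_prod_erase _ (fun i => pareto3 (s i)) (Finset.mem_univ k)]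
  rw [Finset.prod_congr rfl (g := fun i => pareto3 (s i))]
  · simp [mul_comm]
  · intro j hj
    simp [Finset.ne_of_mem_erase hj]

/-- Resampling one coordinate. -/
lemma perturbLaw_real_eq_integral (k : Fin K) {A : Set (Fin K → ℝ)} (hA : MeasurableSet A) :
    (perturbLaw K).real A =
      ∫ x, pareto3.real {y | Function.update x k y ∈ A} ∂perturbLaw K := by
  have hm := measurable_update_pair k
  conv_lhs => rw [← map_update_perturbLaw k]
  rw [measureReal_def, Measure.map_apply hm hA, Measure.prod_apply (hm hA), integral_eq_lintegral_of_nonneg_ae]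
  · congr 1
    refine lintegral_congr fun x => ?_
    rw [measureReal_def, ENNReal.ofReal_toReal (measure_ne_top _ _)]
    rfl
  · exact ae_of_all _ fun x => measureReal_nonneg
  · exact ((measurable_measure_prodMk_left (hm hA)).ennreal_toReal).aestronglyMeasurable

end

/-! ### Winning probabilities and their sensitivity to one coordinate -/

section

variable {K : ℕ}

/-- The perturbations for which arm `k` maximizes `ρ k - g k`. -/
def winSet (g : Fin K → ℝ) (k : Fin K) : Set (Fin K → ℝ) := {ρ | ∀ j, ρ j - g j ≤ ρ k - g k}

/-- The probability that arm `k` maximizes the perturbed value `ρ k - g k`. -/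
def winProb (g : Fin K → ℝ) (k : Fin K) : ℝ := (perturbLaw K).real (winSet g k)

lemma measurableSet_winSet_pair (k : Fin K) :
    MeasurableSet {p : (Fin K → ℝ) × (Fin K → ℝ) | p.2 ∈ winSet p.1 k} := by
  have : {p : (Fin K → ℝ) × (Fin K → ℝ) | p.2 ∈ winSet p.1 k} =
      ⋂ j, {p | p.2 j - p.1 j ≤ p.2 k - p.1 k} := by
    ext p; simp [winSet]
  rw [this]
  exact MeasurableSet.iInter fun j => measurableSet_le (by fun_prop) (by fun_prop)

lemma measurableSet_winSet (g : Fin K → ℝ) (k : Fin K) : MeasurableSet (winSet g k) :=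
  measurable_prodMk_left (measurableSet_winSet_pair k)

lemma measurable_winProb (k : Fin K) : Measurable fun g : Fin K → ℝ => winProb g k :=
  (measurable_measure_prodMk_left (measurableSet_winSet_pair k)).ennreal_toReal

lemma winProb_nonneg (g : Fin K → ℝ) (k : Fin K) : 0 ≤ winProb g k := measureReal_nonneg

lemma winProb_le_one (g : Fin K → ℝ) (k : Fin K) : winProb g k ≤ 1 := measureReal_le_one

lemma winProb_sub_const (g : Fin K → ℝ) (a : ℝ) (k : Fin K) :
    winProb (fun j => g j - a) k = winProb g k := by
  have : winSet (fun j => g j - a) k = winSet g k := by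
    ext ρ
    refine forall_congr' fun j => ?_
    constructor <;> intro h <;> linarith
  rw [winProb, this, winProb]

lemma winSet_add_single_subset (g : Fin K → ℝ) (k : Fin K) {δ : ℝ} (hδ : 0 ≤ δ) :
    winSet (g + Pi.single k δ) k ⊆ winSet g k := by
  intro ρ h j
  have := h j
  by_cases hj : j = k
  · subst hj; exact le_rfl
  · simp [hj] at this; linarith

lemma winProb_add_single_le (g : Fin K → ℝ) (k : Fin K) {δ : ℝ} (hδ : 0 ≤ δ) :
    winProb (g + Pi.single k δ) k ≤ winProb g k :=
  measureReal_mono (winSet_add_single_subset g k hδ)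

/-- The loss of winning probability caused by an increase of one coordinate, by conditioning on the
other perturbations. -/
lemma winProb_sub_le_integral (hK : 2 ≤ K) (g : Fin K → ℝ) (k : Fin K) {δ : ℝ} (hδ : 0 ≤ δ)
    {G : (Fin K → ℝ) → ℝ} (hG : Integrable G (perturbLaw K))
    (h : ∀ᵐ x ∂perturbLaw K, ∀ z, (∃ j, j ≠ k ∧ z = x j - g j + g k) →
      (∀ j, j ≠ k → x j - g j + g k ≤ z) → pareto3.real (Set.Ico z (z + δ)) ≤ G x) :
    winProb g k - winProb (g + Pi.single k δ) k ≤ ∫ x, G x ∂perturbLaw K := by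
  have hm := measurableSet_winSet g k
  have hm' := measurableSet_winSet (g + Pi.single k δ) k
  rw [winProb, winProb, ← measureReal_sdiff (winSet_add_single_subset g k hδ) hm',
    perturbLaw_real_eq_integral k (hm.diff hm')]
  refine integral_mono_of_nonneg (ae_of_all _ fun x => measureReal_nonneg) hG ?_
  filter_upwards [h] with x hx
  have : Nontrivial (Fin K) := Fin.nontrivial_iff_two_le.2 hK
  obtain ⟨j₁, hj₁⟩ := exists_ne k
  -- With z the maximum attained here, arm k wins exactly when its own perturbation is at least z,
  -- and still wins after the increase when it is at least z + δ. Only [z, z + δ) is lost.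
  obtain ⟨j, hj, hmax⟩ := Finset.exists_max_image (Finset.univ.erase k)
    (fun j => x j - g j + g k) ⟨j₁, by simp [hj₁]⟩
  have hjk := Finset.ne_of_mem_erase hj
  refine le_trans (measureReal_mono ?_) (hx _ ⟨j, hjk, rfl⟩ fun i hi => hmax i (by simp [hi]))
  rintro y ⟨h1, h2⟩
  constructor
  · have := h1 j
    simp [hjk] at this; linarith
  · by_contra hc
    refine h2 fun i => ?_
    by_cases hi : i = k
    · subst hi; exact le_rfl
    · have := hmax i (by simp [hi])
      simp only [Function.update_self, Function.update_of_ne hi, Pi.add_apply, Pi.single_eq_same,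
        Pi.single_eq_of_ne hi] at this hc ⊢
      linarith

/-- An arm of gap zero has perturbation at least 1, so any other arm k needs at least 1 + g k to
beat it; if k is itself that arm, 1 + g k = 1. -/
lemma winProb_sub_le_gap (hK : 2 ≤ K) (g : Fin K → ℝ) (hg : ∀ j, 0 ≤ g j) (h0 : ∃ j, g j = 0)
    (k : Fin K) {δ : ℝ} (hδ : 0 ≤ δ) :
    winProb g k - winProb (g + Pi.single k δ) k ≤ 3 * δ * ((1 + g k) ^ 4)⁻¹ := by
  refine (winProb_sub_le_integral hK g k hδ (G := fun _ => 3 * δ * ((1 + g k) ^ 4)⁻¹)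
    (integrable_const _) ?_).trans (by simp)
  filter_upwards [ae_perturbLaw_one_le] with x hx z _ hz
  refine (pareto3_real_Ico_le z hδ).trans ?_
  have hgk := hg k
  have : 1 + g k ≤ max 1 z := by
    obtain ⟨j, hj⟩ := h0
    by_cases hjk : j = k
    · subst hjk; simp [hj]
    · have := hz j hjk
      have := hx j
      exact le_max_of_le_right (by linarith)
  gcongr

/-- A constant bounding scaled moments of the minimum of independent uniform variables. -/
def rankConst : ℝ := 1 + ∑' i : ℕ, (2 * (i : ℝ) + 1) * Real.exp (-(1 / 2)) ^ i

lemma summable_rankConst : Summable fun i : ℕ => (2 * (i : ℝ) + 1) * Real.exp (-(1 / 2)) ^ i := by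
  have h : ‖Real.exp (-(1 / 2))‖ < 1 := by
    rw [Real.norm_of_nonneg (Real.exp_pos _).le, Real.exp_lt_one_iff]; norm_num
  have h1 := summable_pow_mul_geometric_of_norm_lt_one 1 h
  have h0 := summable_pow_mul_geometric_of_norm_lt_one 0 h
  refine ((h1.mul_left 2).add h0).congr fun i => ?_
  simp; ring

lemma one_le_rankConst : 1 ≤ rankConst :=
  le_add_of_nonneg_right (tsum_nonneg fun i => by positivity)

/-- A discrete layer-cake formula: the first n odd numbers sum to n², applied to n = ⌈w⌉. It reduces
a second moment to tail probabilities. -/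
lemma sq_le_sum_indicator {N : ℕ} {w : ℝ} (hw : w ≤ N) (hw0 : 0 ≤ w) :
    w ^ 2 ≤ ∑ i ∈ Finset.range N, (2 * (i : ℝ) + 1) * (if (i : ℝ) < w then 1 else 0) := by
  have hodd : ∀ n : ℕ, (n : ℝ) ^ 2 = ∑ i ∈ Finset.range n, (2 * (i : ℝ) + 1) := by
    intro n
    induction n with
    | zero => simp
    | succ n ih => rw [Finset.sum_range_succ, ← ih]; push_cast; ring
  have hc : ⌈w⌉₊ ≤ N := Nat.ceil_le.2 hw
  calc w ^ 2 ≤ (⌈w⌉₊ : ℝ) ^ 2 := by gcongr; exact Nat.le_ceil w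
    _ = ∑ i ∈ Finset.range ⌈w⌉₊, (2 * (i : ℝ) + 1) * (if (i : ℝ) < w then 1 else 0) := by
        rw [hodd]
        refine Finset.sum_congr rfl fun i hi => ?_
        rw [if_pos (Nat.lt_ceil.1 (Finset.mem_range.1 hi)), mul_one]
    _ ≤ _ := Finset.sum_le_sum_of_subset_of_nonneg (Finset.range_mono hc) fun i _ _ => by
        split_ifs <;> positivity

/-- The event that all perturbations in `S` are small. -/
lemma perturbLaw_forall_lt_le (S : Finset (Fin K)) {N i : ℕ} (hN : S.card + 1 = N) (hi : i < N) :
    (perturbLaw K).real {x | ∀ j ∈ S, (i : ℝ) * max 1 (x j) ^ 3 < N} ≤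
      Real.exp (-(1 / 2)) ^ i := by
  rcases Nat.eq_zero_or_pos i with rfl | hi0
  · simp
  have hiR : (0 : ℝ) < i := by exact_mod_cast hi0
  have hNR : (0 : ℝ) < N := by exact_mod_cast hi0.trans hi
  have hiN : (i : ℝ) < N := by exact_mod_cast hi
  -- The level at which the Pareto tail c⁻³ equals i / N; independence then gives (1 − i/N)^(N−1).
  set c : ℝ := ((N : ℝ) / i) ^ (1 / 3 : ℝ) with hc
  have hc3 : c ^ 3 = N / i := by
    rw [hc, ← Real.rpow_natCast, ← Real.rpow_mul (by positivity)]; norm_num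
  have hc0 : 0 ≤ c := by positivity
  have hc1 : 1 ≤ c := Real.one_le_rpow (by rw [one_le_div hiR]; exact hiN.le) (by norm_num)
  have hsub : {x : Fin K → ℝ | ∀ j ∈ S, (i : ℝ) * max 1 (x j) ^ 3 < N} ⊆
      (S : Set (Fin K)).pi fun _ => Set.Iio c := by
    intro x hx j hj
    have h1 := hx j hj
    rw [mul_comm, ← lt_div_iff₀ hiR, ← hc3] at h1
    exact (le_max_right 1 (x j)).trans_lt (lt_of_pow_lt_pow_left₀ 3 hc0 h1)
  have hIio : pareto3.real (Set.Iio c) = 1 - i / N := by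
    rw [← Set.compl_Ici, probReal_compl_eq_one_sub measurableSet_Ici,
      pareto3_real_Ici_of_one_le hc1, hc3, inv_div]
  refine (measureReal_mono hsub).trans ?_
  rw [measureReal_def, Measure.pi_pi_finset, ENNReal.toReal_prod]
  change ∏ _ ∈ S, pareto3.real (Set.Iio c) ≤ _
  rw [hIio, Finset.prod_const, ← Real.exp_nat_mul]
  have h1 : (1 : ℝ) - i / N ≤ Real.exp (-(i / N)) := Real.one_sub_le_exp_neg _
  have h2 : (0 : ℝ) ≤ 1 - i / N := by rw [sub_nonneg, div_le_one hNR]; exact hiN.le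
  refine (pow_le_pow_left₀ h2 h1 _).trans ?_
  rw [← Real.exp_nat_mul, Real.exp_le_exp]
  have hS : (S.card : ℝ) = N - 1 := by rw [← hN]; push_cast; ring
  have hN2 : (2 : ℝ) ≤ N := by
    have : 2 ≤ N := by omega
    exact_mod_cast this
  -- Only N − 1 arms precede k, so the exponent is i(N−1)/N rather than i; this is the origin of the
  -- 1/2 in `rankConst`.
  have : (1 / 2 : ℝ) ≤ (N - 1) / N := by rw [le_div_iff₀ hNR]; linarith
  rw [hS]
  have h3 := mul_le_mul_of_nonneg_right this hiR.le
  calc ((N : ℝ) - 1) * -(i / N) = -((N - 1) / N * i) := by ring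
    _ ≤ -(1 / 2 * i) := neg_le_neg h3
    _ = _ := by ring

/-- Arm k must beat the N − 1 arms ranked before it, none of which has a larger gap. The threshold
is thus at least the maximum of their perturbations, which is typically of order N^(1/3), and the
density there is of order N^(−4/3). -/
lemma winProb_sub_le_rank (hK : 2 ≤ K) (g : Fin K → ℝ) (σ : Equiv.Perm (Fin K))
    (hσ : IsRanking g σ) (k : Fin K) {δ : ℝ} (hδ : 0 ≤ δ) :
    winProb g k - winProb (g + Pi.single k δ) k ≤
      3 * δ * (rankConst * (1 / (((σ k : ℕ) + 1 : ℝ) ^ (1 / 3 : ℝ))) ^ 4) := by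
  set N : ℕ := (σ k : ℕ) + 1 with hN
  set a : ℝ := (N : ℝ) ^ (1 / 3 : ℝ) with ha
  have hNR : (0 : ℝ) < N := by positivity
  have ha0 : 0 < a := by positivity
  have ha3 : a ^ 3 = N := by
    rw [ha, ← Real.rpow_natCast, ← Real.rpow_mul (by positivity)]; norm_num
  set S : Finset (Fin K) := Finset.univ.filter fun j => σ j < σ k with hS
  have hScard : S.card + 1 = N := by
    have : S = (Finset.Iio (σ k)).map σ.symm.toEmbedding := by
      ext j; simp [hS]
    rw [this, Finset.card_map, Fin.card_Iio]
  set E : ℕ → Set (Fin K → ℝ) := fun i => {x | ∀ j ∈ S, (i : ℝ) * max 1 (x j) ^ 3 < N} with hE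
  have hEm : ∀ i, MeasurableSet (E i) := by
    intro i
    simp only [hE, Set.ofPred_forall]
    exact MeasurableSet.iInter fun j => MeasurableSet.iInter fun _ =>
      measurableSet_lt (by fun_prop) (by fun_prop)
  set G : (Fin K → ℝ) → ℝ := fun x => 3 * δ * ((1 / a) ^ 4 *
    (1 + ∑ i ∈ Finset.range N, (2 * (i : ℝ) + 1) * (E i).indicator (fun _ => 1) x)) with hGdef
  have hint : ∀ i ∈ Finset.range N, Integrable (fun x =>
      (2 * (i : ℝ) + 1) * (E i).indicator (fun _ => (1 : ℝ)) x) (perturbLaw K) := fun i _ =>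
    ((integrable_const _).indicator (hEm i)).const_mul _
  have hG : Integrable G (perturbLaw K) :=
    (((integrable_const _).add (integrable_finsetSum _ hint)).const_mul _).const_mul _
  have hmain : winProb g k - winProb (g + Pi.single k δ) k ≤ ∫ x, G x ∂perturbLaw K := by
    refine winProb_sub_le_integral hK g k hδ hG (ae_of_all _ fun x z hz1 hz2 => ?_)
    refine (pareto3_real_Ico_le z hδ).trans ?_
    refine mul_le_mul_of_nonneg_left ?_ (by positivity)
    set v := max 1 z with hv
    have hv1 : 1 ≤ v := le_max_left _ _
    have hv0 : 0 < v := by linarith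
    have hxv : ∀ j ∈ S, max 1 (x j) ≤ v := by
      intro j hj
      have hjk : σ j < σ k := by simpa [hS] using hj
      have hne : j ≠ k := by rintro rfl; exact lt_irrefl _ hjk
      have hle : g j ≤ g k := by
        by_contra hc
        exact lt_asymm hjk (hσ k j (not_le.1 hc))
      have := hz2 j hne
      exact max_le hv1 (le_max_of_le_right (by linarith))
    have hw : (N : ℝ) * (v ^ 3)⁻¹ ≤ N :=
      mul_le_of_le_one_right hNR.le (inv_le_one_of_one_le₀ (one_le_pow₀ hv1))
    have h1 := sq_le_sum_indicator hw (by positivity)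
    have h2 : ∑ i ∈ Finset.range N, (2 * (i : ℝ) + 1) *
          (if (i : ℝ) < (N : ℝ) * (v ^ 3)⁻¹ then 1 else 0) ≤
        ∑ i ∈ Finset.range N, (2 * (i : ℝ) + 1) * (E i).indicator (fun _ => 1) x := by
      refine Finset.sum_le_sum fun i _ => mul_le_mul_of_nonneg_left ?_ (by positivity)
      split_ifs with hi
      · rw [Set.indicator_of_mem]
        intro j hj
        rw [← div_eq_mul_inv, lt_div_iff₀ (by positivity)] at hi
        refine lt_of_le_of_lt ?_ hi
        gcongr
        exact hxv j hj
      · exact Set.indicator_nonneg (fun _ _ => zero_le_one) x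
    -- The fourth power is replaced by the sixth, which is the square of N / v³ and so fits the
    -- layer-cake sum.
    have h3 : (a * v⁻¹) ^ 4 ≤ 1 + (a * v⁻¹) ^ 6 := by
      nlinarith [sq_nonneg ((a * v⁻¹) ^ 2 - 1), sq_nonneg (a * v⁻¹),
        mul_nonneg (sq_nonneg (a * v⁻¹)) (sq_nonneg ((a * v⁻¹) ^ 2 - 1))]
    have h4 : (a * v⁻¹) ^ 6 = ((N : ℝ) * (v ^ 3)⁻¹) ^ 2 := by rw [← ha3]; ring
    calc (v ^ 4)⁻¹ = (1 / a) ^ 4 * (a * v⁻¹) ^ 4 := by field_simp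
      _ ≤ _ := by
        refine mul_le_mul_of_nonneg_left ?_ (by positivity)
        linarith
  refine hmain.trans ?_
  have hcast : (((σ k : ℕ) : ℝ) + 1) = (N : ℝ) := by rw [hN]; push_cast; ring
  rw [hcast, ← ha, hGdef]
  rw [integral_const_mul, integral_const_mul, integral_add (integrable_const _)
    (integrable_finsetSum _ hint), integral_finsetSum _ hint]
  refine mul_le_mul_of_nonneg_left ?_ (by positivity)
  rw [mul_comm rankConst]
  refine mul_le_mul_of_nonneg_left ?_ (by positivity)
  simp only [integral_const, probReal_univ, smul_eq_mul, one_mul, rankConst]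
  gcongr
  refine le_trans (Finset.sum_le_sum fun i hi => ?_)
    (summable_rankConst.sum_le_tsum (Finset.range N) fun i _ => by positivity)
  rw [integral_const_mul, integral_indicator (hEm i)]
  refine mul_le_mul_of_nonneg_left ?_ (by positivity)
  simpa using perturbLaw_forall_lt_le S hScard (Finset.mem_range.1 hi)

/-- The cube root of the upper bound for the winning probability of arm `k`. -/
def score (g : Fin K → ℝ) (σ : Equiv.Perm (Fin K)) (k : Fin K) : ℝ :=
  min (1 / (1 + g k)) (1 / (((σ k : ℕ) + 1 : ℝ) ^ (1 / 3 : ℝ)))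

lemma score_pos {g : Fin K → ℝ} (hg : ∀ j, 0 ≤ g j) (σ : Equiv.Perm (Fin K)) (k : Fin K) :
    0 < score g σ k := by
  have := hg k
  unfold score
  positivity

/-- The gap bound and the rank bound have the same shape, so whichever realizes the minimum in
`score` applies. -/
lemma winProb_sub_le_score (hK : 2 ≤ K) (g : Fin K → ℝ) (hg : ∀ j, 0 ≤ g j) (h0 : ∃ j, g j = 0)
    (σ : Equiv.Perm (Fin K)) (hσ : IsRanking g σ) (k : Fin K) {δ : ℝ} (hδ : 0 ≤ δ) :
    winProb g k - winProb (g + Pi.single k δ) k ≤ 3 * rankConst * δ * score g σ k ^ 4 := by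
  have h1 := winProb_sub_le_gap hK g hg h0 k hδ
  have h2 := winProb_sub_le_rank hK g σ hσ k hδ
  have hc := one_le_rankConst
  have hgk := hg k
  unfold score
  rcases min_choice (1 / (1 + g k)) (1 / (((σ k : ℕ) + 1 : ℝ) ^ (1 / 3 : ℝ))) with h | h <;> rw [h]
  · refine h1.trans ?_
    rw [one_div, inv_pow]
    refine mul_le_mul_of_nonneg_right ?_ (by positivity)
    nlinarith
  · exact h2.trans_eq (by ring)

end

/-! ### The leading arm, the mass of the others, and the potential -/

section

variable {K : ℕ}

/-- The leading arm can only lose winning probability in proportion to the mass of the others. -/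
lemma winProb_sub_le_leader (hK : 2 ≤ K) (g : Fin K → ℝ) (hg : ∀ j, 0 ≤ g j) (b : Fin K)
    (hb : g b = 0) {δ : ℝ} (hδ : 0 ≤ δ) (hδ' : δ ≤ 1 / 2) :
    winProb g b - winProb (g + Pi.single b δ) b ≤
      24 * δ * ∑ j ∈ Finset.univ.erase b, ((1 + g j) ^ 3)⁻¹ := by
  set E : Fin K → Set (Fin K → ℝ) := fun j => {x | x j ∈ Set.Ici (1 / 2 + g j)} with hE
  have hEm : ∀ j, MeasurableSet (E j) := fun j => measurable_pi_apply j measurableSet_Ici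
  have hint : ∀ j ∈ Finset.univ.erase b, Integrable
      (fun x => (E j).indicator (fun _ => (1 : ℝ)) x) (perturbLaw K) := fun j _ =>
    (integrable_const _).indicator (hEm j)
  have hG : Integrable (fun x => 3 * δ * ∑ j ∈ Finset.univ.erase b,
      (E j).indicator (fun _ => (1 : ℝ)) x) (perturbLaw K) :=
    (integrable_finsetSum _ hint).const_mul _
  have hnn : ∀ x, ∀ j ∈ Finset.univ.erase b, 0 ≤ (E j).indicator (fun _ => (1 : ℝ)) x :=
    fun x j _ => Set.indicator_nonneg (fun _ _ => zero_le_one) x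
  refine (winProb_sub_le_integral hK g b hδ hG (ae_of_all _ fun x z hz _ => ?_)).trans ?_
  · obtain ⟨j, hj, rfl⟩ := hz
    set z := x j - g j + g b with hz
    by_cases hx : x ∈ E j
    · refine (pareto3_real_Ico_le z hδ).trans (mul_le_mul_of_nonneg_left ?_ (by positivity))
      calc (max 1 z ^ 4)⁻¹ ≤ 1 := inv_le_one_of_one_le₀ (one_le_pow₀ (le_max_left _ _))
        _ = (E j).indicator (fun _ => (1 : ℝ)) x := by rw [Set.indicator_of_mem hx]
        _ ≤ _ := Finset.single_le_sum (hnn x) (by simp [hj])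
    · have h1 : z + δ ≤ 1 := by
        have : x j < 1 / 2 + g j := by simpa [hE] using hx
        linarith
      have h2 : pareto3.real (Set.Ico z (z + δ)) = 0 := by
        rw [measureReal_def, ENNReal.toReal_eq_zero_iff]
        left
        refine measure_mono_null (t := {y | ¬ 1 ≤ y}) (fun y hy => ?_)
          (ae_iff.1 ae_pareto3_one_le)
        exact not_le.2 (hy.2.trans_le h1)
      rw [h2]
      exact mul_nonneg (by positivity) (Finset.sum_nonneg (hnn x))
  · rw [integral_const_mul, integral_finsetSum _ hint, Finset.mul_sum, Finset.mul_sum]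
    refine Finset.sum_le_sum fun j _ => ?_
    have hgj := hg j
    have h1 : (1 + g j) / 2 ≤ max 1 (1 / 2 + g j) := le_max_of_le_right (by linarith)
    rw [integral_indicator (hEm j)]
    simp only [integral_const, measureReal_restrict_apply_univ, smul_eq_mul, mul_one]
    rw [perturbLaw_real_eval j measurableSet_Ici, pareto3_real_Ici]
    calc 3 * δ * (max 1 (1 / 2 + g j) ^ 3)⁻¹ ≤ 3 * δ * (((1 + g j) / 2) ^ 3)⁻¹ := by gcongr
      _ = _ := by field_simp; ring

lemma one_add_sum_mul_prod_one_sub_le {ι : Type*} (s : Finset ι) (a : ι → ℝ)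
    (h0 : ∀ i ∈ s, 0 ≤ a i) (h1 : ∀ i ∈ s, a i ≤ 1) :
    (1 + ∑ i ∈ s, a i) * ∏ i ∈ s, (1 - a i) ≤ 1 := by
  classical
  induction s using Finset.induction_on with
  | empty => simp
  | insert i s hi ih =>
    rw [Finset.sum_insert hi, Finset.prod_insert hi]
    have hs : ∀ j ∈ s, j ∈ insert i s := fun j hj => Finset.mem_insert_of_mem hj
    have ih := ih (fun j hj => h0 j (hs j hj)) fun j hj => h1 j (hs j hj)
    have hP : 0 ≤ ∏ j ∈ s, (1 - a j) :=
      Finset.prod_nonneg fun j hj => sub_nonneg.2 (h1 j (hs j hj))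
    have hS : 0 ≤ ∑ j ∈ s, a j := Finset.sum_nonneg fun j hj => h0 j (hs j hj)
    have ha := h0 i (Finset.mem_insert_self i s)
    have : 0 ≤ a i * (∏ j ∈ s, (1 - a j)) * (∑ j ∈ s, a j + a i) := by positivity
    linarith

/-- The probability that `b` does not win dominates the mass of the other arms. -/
lemma min_one_mass_le (g : Fin K → ℝ) (hg : ∀ j, 0 ≤ g j) (b : Fin K) :
    min 1 (∑ j ∈ Finset.univ.erase b, ((1 + g j) ^ 3)⁻¹) ≤ 11 * (1 - winProb g b) := by
  classical
  set a : Fin K → ℝ := fun j => ((2 + g j) ^ 3)⁻¹ with ha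
  set A := ∑ j ∈ Finset.univ.erase b, a j with hA
  set y := ∑ j ∈ Finset.univ.erase b, ((1 + g j) ^ 3)⁻¹ with hy
  have ha0 : ∀ j, 0 ≤ a j := fun j => by have := hg j; positivity
  have ha1 : ∀ j, a j ≤ 1 := fun j =>
    inv_le_one_of_one_le₀ (one_le_pow₀ (by have := hg j; linarith))
  have hyA : y ≤ 8 * A := by
    rw [hy, hA, Finset.mul_sum]
    refine Finset.sum_le_sum fun j _ => ?_
    have hgj := hg j
    calc ((1 + g j) ^ 3)⁻¹ = 8 * ((2 * (1 + g j)) ^ 3)⁻¹ := by field_simp; norm_num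
      _ ≤ 8 * a j := by
        simp only [ha]; gcongr; linarith
  have hA0 : 0 ≤ A := Finset.sum_nonneg fun j _ => ha0 j
  have hIio : ∀ z : ℝ, 1 ≤ z → pareto3.real (Set.Iio z) = 1 - (z ^ 3)⁻¹ := fun z hz => by
    rw [← Set.compl_Ici, probReal_compl_eq_one_sub measurableSet_Ici,
      pareto3_real_Ici_of_one_le hz]
  -- Arm b loses as soon as its perturbation is below 2 while some other one is at least 2 + g j.
  -- The difference `B₁ \ B₂` is this event.
  set s : Fin K → Set ℝ := fun j => if j = b then Set.Iio 2 else Set.Iio (2 + g j) with hs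
  set B₁ : Set (Fin K → ℝ) := {x | x b ∈ Set.Iio 2} with hB₁
  set B₂ : Set (Fin K → ℝ) := Set.univ.pi s with hB₂
  have hB₂m : MeasurableSet B₂ := MeasurableSet.univ_pi fun j => by
    simp only [hs]; split_ifs <;> exact measurableSet_Iio
  have hsub : B₂ ⊆ B₁ := fun x hx => by
    simpa [hs, hB₁] using hx b (Set.mem_univ b)
  have hP₁ : (perturbLaw K).real B₁ = 7 / 8 := by
    rw [hB₁, perturbLaw_real_eval b measurableSet_Iio, hIio 2 (by norm_num)]; norm_num
  have hP₂ : (perturbLaw K).real B₂ = 7 / 8 * ∏ j ∈ Finset.univ.erase b, (1 - a j) := by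
    rw [measureReal_def, hB₂, Measure.pi_pi, ENNReal.toReal_prod,
      ← Finset.mul_prod_erase _ _ (Finset.mem_univ b)]
    congr 1
    · simp only [hs, if_true]
      exact (hIio 2 (by norm_num)).trans (by norm_num)
    · refine Finset.prod_congr rfl fun j hj => ?_
      simp only [hs, if_neg (Finset.ne_of_mem_erase hj)]
      exact hIio _ (by have := hg j; linarith)
  have hwin : B₁ \ B₂ ⊆ (winSet g b)ᶜ := by
    rintro x ⟨h1, h2⟩ hwin
    refine h2 fun j _ => ?_
    have h1' : x b < 2 := h1
    by_cases hj : j = b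
    · subst hj; simpa [hs] using h1'
    · have := hwin j
      have := hg b
      simp only [hs, if_neg hj, Set.mem_Iio]
      linarith
  have hx : 7 / 8 - 7 / 8 * ∏ j ∈ Finset.univ.erase b, (1 - a j) ≤ 1 - winProb g b := by
    rw [winProb, ← probReal_compl_eq_one_sub (measurableSet_winSet g b), ← hP₂, ← hP₁,
      ← measureReal_sdiff hsub hB₂m]
    exact measureReal_mono hwin
  have hprod := one_add_sum_mul_prod_one_sub_le (Finset.univ.erase b) a
    (fun j _ => ha0 j) (fun j _ => ha1 j)
  rw [← hA] at hprod
  set P := ∏ j ∈ Finset.univ.erase b, (1 - a j)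
  have hmain : 7 / 8 * A ≤ (1 - winProb g b) * (1 + A) := by nlinarith
  -- `hmain` gives 1 − winProb ≥ (7/8)·A/(1 + A). For A ≥ 1/8 this is at least 7/72 > 1/11; for A ≤
  -- 1/8 it gives y ≤ 8A ≤ (72/7)(1 − winProb).
  rcases le_total (1 / 8) A with h | h
  · refine (min_le_left _ _).trans ?_
    nlinarith
  · refine (min_le_right _ _).trans ?_
    have hw := winProb_le_one g b
    nlinarith

/-- The expected minimum of the perturbed losses, relative to the perturbation of arm `b`. -/
def potential (b : Fin K) (β : ℝ) (L : Fin K → ℝ) : ℝ :=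
  ∫ ρ, ⨅ i, (L i - β * (ρ i - ρ b)) ∂perturbLaw K

lemma ciInf_fin_le (f : Fin K → ℝ) (i : Fin K) : ⨅ j, f j ≤ f i :=
  ciInf_le (Set.finite_range f).bddBelow i

lemma integrable_potential (b : Fin K) (β : ℝ) (L : Fin K → ℝ) :
    Integrable (fun ρ : Fin K → ℝ => ⨅ i, (L i - β * (ρ i - ρ b))) (perturbLaw K) := by
  have : Nonempty (Fin K) := ⟨b⟩
  have hi : ∀ i : Fin K, Integrable (fun ρ : Fin K → ℝ => L i - β * (ρ i - ρ b))
      (perturbLaw K) := fun i =>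
    (integrable_const _).sub (((integrable_comp_eval integrable_id_pareto3 i).sub
      (integrable_comp_eval integrable_id_pareto3 b)).const_mul _)
  refine (integrable_finsetSum Finset.univ fun i _ => (hi i).norm).mono' ?_
    (ae_of_all _ fun ρ => ?_)
  · exact (Measurable.iInf fun i => by fun_prop).aestronglyMeasurable
  · obtain ⟨i, hi⟩ := exists_eq_ciInf_of_finite (f := fun i => L i - β * (ρ i - ρ b))
    rw [← hi]
    exact Finset.single_le_sum (f := fun i => ‖L i - β * (ρ i - ρ b)‖)
      (fun _ _ => norm_nonneg _) (Finset.mem_univ i)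

/-- The index b contributes exactly L b, because perturbations are measured relative to ρ b; the
comparison with b costs no extra mean perturbation. -/
lemma potential_le (b : Fin K) (β : ℝ) (L : Fin K → ℝ) : potential b β L ≤ L b := by
  calc potential b β L ≤ ∫ _, L b ∂perturbLaw K :=
        integral_mono (integrable_potential b β L) (integrable_const _) fun ρ =>
          (ciInf_fin_le _ b).trans (by simp)
    _ = L b := by simp

lemma potential_zero (b : Fin K) : potential b 0 (0 : Fin K → ℝ) = 0 := by
  have : Nonempty (Fin K) := ⟨b⟩
  simp [potential]

lemma mem_winSet_iff {η : ℝ} (hη : 0 < η) (L ρ : Fin K → ℝ) (k : Fin K) :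
    ρ ∈ winSet (η • L) k ↔ ∀ j, L k - ρ k / η ≤ L j - ρ j / η := by
  refine forall_congr' fun j => ?_
  simp only [Pi.smul_apply, smul_eq_mul]
  have h : ∀ i, η * (L i - ρ i / η) = η * L i - ρ i := fun i => by field_simp
  rw [← mul_le_mul_iff_right₀ hη (b := L k - ρ k / η), h, h]
  constructor <;> intro h <;> linarith

lemma ciInf_eq_of_mem_winSet {η : ℝ} (hη : 0 < η) {L ρ : Fin K → ℝ} {k : Fin K}
    (h : ρ ∈ winSet (η • L) k) (b : Fin K) :
    ⨅ i, (L i - η⁻¹ * (ρ i - ρ b)) = L k - η⁻¹ * (ρ k - ρ b) := by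
  have : Nonempty (Fin K) := ⟨b⟩
  refine le_antisymm (ciInf_fin_le _ k) (le_ciInf fun j => ?_)
  have := (mem_winSet_iff hη L ρ k).1 h j
  simp only [div_eq_inv_mul] at this
  linarith

lemma exists_mem_winSet [Nonempty (Fin K)] (g ρ : Fin K → ℝ) : ∃ k, ρ ∈ winSet g k := by
  obtain ⟨k, hk⟩ := Finite.exists_max fun j => ρ j - g j
  exact ⟨k, hk⟩

/-- The price of a decrease of the learning rate. -/
lemma potential_sub_le (b : Fin K) {η β M : ℝ} (hη : 0 < η) (hβ : β ≤ η⁻¹) (hM : 1 ≤ M)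
    (L : Fin K → ℝ) :
    potential b β L - potential b η⁻¹ L ≤
      (η⁻¹ - β) * (M * (1 - winProb (η • L) b) + 3 / 2 * (K / M ^ 2)) := by
  have : Nonempty (Fin K) := ⟨b⟩
  set A := (winSet (η • L) b)ᶜ with hA
  have hAm : MeasurableSet A := (measurableSet_winSet _ _).compl
  have hA1 : Integrable (fun ρ => M * A.indicator (fun _ => (1 : ℝ)) ρ) (perturbLaw K) :=
    ((integrable_const _).indicator hAm).const_mul _
  have hS : ∀ k ∈ Finset.univ, Integrable (fun ρ : Fin K → ℝ => (Set.Ioi M).indicator id (ρ k))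
      (perturbLaw K) := fun k _ => integrable_comp_eval (integrable_indicator_pareto3 hM) k
  have hint : Integrable (fun ρ : Fin K → ℝ => (η⁻¹ - β) * (M * A.indicator (fun _ => (1 : ℝ)) ρ +
      ∑ k, (Set.Ioi M).indicator id (ρ k))) (perturbLaw K) :=
    (hA1.add (integrable_finsetSum _ hS)).const_mul _
  have hβ' : 0 ≤ η⁻¹ - β := by linarith
  rw [potential, potential, ← integral_sub (integrable_potential _ _ _)
    (integrable_potential _ _ _)]
  have hnn : ∀ y : ℝ, 0 ≤ (Set.Ioi M).indicator id y := fun y =>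
    Set.indicator_nonneg (fun y (hy : M < y) => by simp only [id]; linarith) y
  calc _ ≤ ∫ ρ, (η⁻¹ - β) * (M * A.indicator (fun _ => (1 : ℝ)) ρ +
      ∑ k, (Set.Ioi M).indicator id (ρ k)) ∂perturbLaw K := by
        refine integral_mono_ae ((integrable_potential _ _ _).sub (integrable_potential _ _ _))
          hint ?_
        filter_upwards [ae_perturbLaw_one_le] with ρ hρ
        have hsum : 0 ≤ ∑ k, (Set.Ioi M).indicator id (ρ k) := Finset.sum_nonneg fun k _ => hnn _
        -- Inserting the winner at η⁻¹ into the minimum at β leaves a multiple of ρ k − ρ b. It is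
        -- zero if b wins; otherwise ρ k is at most M or is counted in the tail sum.
        have key : ∀ k, ρ ∈ winSet (η • L) k →
            (⨅ i, (L i - β * (ρ i - ρ b))) - ⨅ i, (L i - η⁻¹ * (ρ i - ρ b)) ≤
              (η⁻¹ - β) * (ρ k - ρ b) := fun k hk => by
          rw [ciInf_eq_of_mem_winSet hη hk b]
          have := ciInf_fin_le (fun i => L i - β * (ρ i - ρ b)) k
          linarith
        by_cases hb : ρ ∈ winSet (η • L) b
        · refine (key b hb).trans (mul_le_mul_of_nonneg_left ?_ hβ')
          have : ρ ∉ A := fun h => h hb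
          rw [Set.indicator_of_notMem this]
          linarith
        · obtain ⟨k, hk⟩ := exists_mem_winSet (η • L) ρ
          refine (key k hk).trans (mul_le_mul_of_nonneg_left ?_ hβ')
          rw [Set.indicator_of_mem hb, mul_one]
          have h1 := hρ b
          rcases le_or_gt (ρ k) M with h | h
          · linarith
          · have h2 : ρ k = (Set.Ioi M).indicator id (ρ k) := by
              rw [Set.indicator_of_mem (show ρ k ∈ Set.Ioi M from h), id]
            have h3 := Finset.single_le_sum (f := fun k => (Set.Ioi M).indicator id (ρ k))
              (fun k _ => hnn _) (Finset.mem_univ k)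
            simp only [← h2] at h3
            linarith
    _ = _ := by
        rw [integral_const_mul, integral_add hA1 (integrable_finsetSum _ hS), integral_const_mul,
          integral_finsetSum _ hS, integral_indicator hAm]
        have h1 : ∀ k ∈ Finset.univ, ∫ ρ : Fin K → ℝ, (Set.Ioi M).indicator id (ρ k) ∂perturbLaw K
            = 3 / 2 * (M ^ 2)⁻¹ := fun k _ => by
          rw [integral_comp_eval (integrable_indicator_pareto3 hM).aestronglyMeasurable k,
            integral_indicator_pareto3 hM]
        rw [Finset.sum_congr rfl h1]
        simp only [integral_const, measureReal_restrict_apply_univ, smul_eq_mul, mul_one, hA,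
          probReal_compl_eq_one_sub (measurableSet_winSet _ _), Finset.sum_const,
          Finset.card_univ, Fintype.card_fin, nsmul_eq_mul, winProb]
        ring

/-- The potential grows at least by the added loss of the arm that still wins. -/
lemma mul_winProb_le_potential_sub (b j : Fin K) {η v : ℝ} (hη : 0 < η) (hv : 0 ≤ v)
    (L : Fin K → ℝ) :
    v * winProb (η • (L + Pi.single j v)) j ≤
      potential b η⁻¹ (L + Pi.single j v) - potential b η⁻¹ L := by
  have : Nonempty (Fin K) := ⟨b⟩
  set A := winSet (η • (L + Pi.single j v)) j with hA
  have hAm : MeasurableSet A := measurableSet_winSet _ _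
  rw [potential, potential, ← integral_sub (integrable_potential _ _ _)
    (integrable_potential _ _ _)]
  have h1 : v * winProb (η • (L + Pi.single j v)) j =
      ∫ ρ, v * A.indicator (fun _ => (1 : ℝ)) ρ ∂perturbLaw K := by
    rw [integral_const_mul, integral_indicator hAm]
    simp [winProb, hA]
  rw [h1]
  refine integral_mono (((integrable_const _).indicator hAm).const_mul _)
    ((integrable_potential _ _ _).sub (integrable_potential _ _ _)) fun ρ => ?_
  -- If j wins after the increase, the minimum is attained at j and was lower by at least v before.
  -- Elsewhere monotonicity suffices.
  by_cases hρ : ρ ∈ A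
  · simp only [Set.indicator_of_mem hρ, mul_one]
    rw [ciInf_eq_of_mem_winSet hη hρ b]
    have := ciInf_fin_le (fun i => L i - η⁻¹ * (ρ i - ρ b)) j
    simp only [Pi.add_apply, Pi.single_eq_same]
    linarith
  · simp only [Set.indicator_of_notMem hρ, mul_zero, sub_nonneg]
    refine le_ciInf fun i => (ciInf_fin_le _ i).trans ?_
    have : 0 ≤ (Pi.single j v : Fin K → ℝ) i := by
      by_cases h : i = j
      · subst h; simpa
      · simp [h]
    simp only [Pi.add_apply]
    linarith

end

/-! ### Stability of the winning probabilities under the loss estimates -/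

section

variable {K : ℕ}

lemma sum_range_rpow_neg_le (n : ℕ) :
    ∑ i ∈ Finset.range n, (1 / (((i : ℝ) + 1) ^ (1 / 3 : ℝ))) ^ 2 ≤ 3 * (n : ℝ) ^ (1 / 3 : ℝ) := by
  induction n with
  | zero => simp
  | succ n ih =>
    rw [Finset.sum_range_succ]
    push_cast
    set u := ((n : ℝ) + 1) ^ (1 / 3 : ℝ) with hu
    set v := (n : ℝ) ^ (1 / 3 : ℝ) with hv
    have hu3 : u ^ 3 = n + 1 := by
      rw [hu, ← Real.rpow_natCast, ← Real.rpow_mul (by positivity)]; norm_num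
    have hv3 : v ^ 3 = n := by
      rw [hv, ← Real.rpow_natCast, ← Real.rpow_mul (by positivity)]; norm_num
    have hu0 : 0 < u := by positivity
    have hv0 : 0 ≤ v := by positivity
    have hvu : v ≤ u := by rw [hu, hv]; gcongr; linarith
    -- From u³ − v³ = 1, with the cofactor u² + uv + v² at most 3u².
    have h : (1 / u) ^ 2 ≤ 3 * (u - v) := by
      rw [div_pow, one_pow, div_le_iff₀ (by positivity)]
      have h1 : (u - v) * (u ^ 2 + u * v + v ^ 2) = 1 := by linear_combination hu3 - hv3
      have h2 : (u - v) * (u ^ 2 + u * v + v ^ 2) ≤ (u - v) * (3 * u ^ 2) :=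
        mul_le_mul_of_nonneg_left (by nlinarith) (by linarith)
      linarith
    linarith

/-- Ranks run through each of 1, …, K once, so the rank half of the minimum leaves the sum of
n^(−2/3). -/
lemma sum_score_sq_le {g : Fin K → ℝ} (hg : ∀ j, 0 ≤ g j) (σ : Equiv.Perm (Fin K)) :
    ∑ k, score g σ k ^ 2 ≤ 3 * (K : ℝ) ^ (1 / 3 : ℝ) := by
  calc ∑ k, score g σ k ^ 2 ≤ ∑ k, (1 / (((σ k : ℕ) + 1 : ℝ) ^ (1 / 3 : ℝ))) ^ 2 :=
        Finset.sum_le_sum fun k _ =>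
          pow_le_pow_left₀ (score_pos hg σ k).le (min_le_right _ _) 2
    _ = ∑ k : Fin K, (1 / (((k : ℕ) + 1 : ℝ) ^ (1 / 3 : ℝ))) ^ 2 :=
        Equiv.sum_comp σ fun k : Fin K => (1 / (((k : ℕ) + 1 : ℝ) ^ (1 / 3 : ℝ))) ^ 2
    _ = ∑ i ∈ Finset.range K, (1 / (((i : ℝ) + 1) ^ (1 / 3 : ℝ))) ^ 2 :=
        Fin.sum_univ_eq_sum_range (fun i : ℕ => (1 / (((i : ℝ) + 1) ^ (1 / 3 : ℝ))) ^ 2) K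
    _ ≤ _ := sum_range_rpow_neg_le K

lemma lossGap_nonneg (L : Fin K → ℝ) (k : Fin K) : 0 ≤ lossGap L k :=
  sub_nonneg.2 (ciInf_fin_le L k)

lemma exists_lossGap_eq_zero [Nonempty (Fin K)] (L : Fin K → ℝ) : ∃ k, lossGap L k = 0 := by
  obtain ⟨k, hk⟩ := exists_eq_ciInf_of_finite (f := L)
  exact ⟨k, sub_eq_zero.2 hk⟩

lemma IsRanking.smul_lossGap {L : Fin K → ℝ} {σ : Equiv.Perm (Fin K)} (h : IsRanking L σ)
    {η : ℝ} (hη : 0 < η) : IsRanking (fun k => η * lossGap L k) σ := by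
  intro i j hij
  refine h i j ?_
  have := lt_of_mul_lt_mul_left hij hη.le
  unfold lossGap at this
  linarith

lemma exploreWeight_eq_score_sq (η : ℝ) (L : Fin K → ℝ) (σ : Equiv.Perm (Fin K))
    (k : Fin K) : exploreWeight 3 η L σ k = score (fun k => η * lossGap L k) σ k ^ 2 := by
  rw [exploreWeight, show ((3 : ℝ) + 1) / 2 = ((2 : ℕ) : ℝ) by norm_num, Real.rpow_natCast]
  rfl

lemma exploreProb_eq (η : ℝ) (L : Fin K → ℝ) (σ : Equiv.Perm (Fin K))
    (k : Fin K) : exploreProb 3 η L σ k = score (fun k => η * lossGap L k) σ k ^ 2 /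
      ∑ j, score (fun k => η * lossGap L k) σ j ^ 2 := by
  simp only [exploreProb, exploreWeight_eq_score_sq]

/-- Winning is invariant under a common shift, so scaled losses may be replaced by scaled gaps,
which are nonnegative with minimum 0. -/
lemma winProb_smul (η : ℝ) (L : Fin K → ℝ) (k : Fin K) :
    winProb (η • L) k = winProb (fun k => η * lossGap L k) k := by
  rw [← winProb_sub_const (η • L) (η * ⨅ j, L j)]
  congr 1
  ext j
  simp [lossGap]; ring

lemma winProb_smul_add_single (η v : ℝ) (L : Fin K → ℝ) (k : Fin K) :
    winProb (η • (L + Pi.single k v)) k =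
      winProb ((fun k => η * lossGap L k) + Pi.single k (η * v)) k := by
  refine (winProb_sub_const (η • (L + Pi.single k v)) (η * ⨅ j, L j) k).symm.trans ?_
  congr 1
  ext j
  by_cases h : j = k
  · subst h; simp [lossGap]; ring
  · simp [lossGap, h]; ring

/-- The expected change of the loss when the winning probabilities are updated after an estimate of
`ℓ` has been added. -/
def stability (η : ℝ) (L : Fin K → ℝ) (σ : Equiv.Perm (Fin K)) (ℓ : Fin K → ℝ) : ℝ :=
  ∑ k, ℓ k * (winProb (η • L) k -
    winProb (η • (L + Pi.single k (ℓ k / exploreProb 3 η L σ k))) k)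

/-- Trades the square of the score, which the stability produces, for its cube, which the
probability of a suboptimal arm controls. -/
lemma sq_le_mul_cube_add {s a : ℝ} (hs : 0 ≤ s) (ha : 0 < a) : s ^ 2 ≤ a * s ^ 3 + 1 / a ^ 2 := by
  rcases le_total 1 (a * s) with h | h
  · have h1 : s ^ 2 * 1 ≤ s ^ 2 * (a * s) := mul_le_mul_of_nonneg_left h (sq_nonneg s)
    have : 0 ≤ 1 / a ^ 2 := by positivity
    nlinarith
  · have h1 : s ^ 2 ≤ 1 / a ^ 2 := by
      rw [le_div_iff₀ (by positivity)]
      nlinarith [mul_nonneg ha.le hs]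
    have : 0 ≤ a * s ^ 3 := by positivity
    linarith

/-- The importance weight is the sum of squared scores over score², and the sensitivity is of order
score⁴. Two powers of the score survive, and their sum over the arms is again the normalizer. -/
lemma stability_term_le (hK : 2 ≤ K) {η : ℝ} (hη : 0 < η) {L : Fin K → ℝ}
    {σ : Equiv.Perm (Fin K)} (hσ : IsRanking L σ) {ℓ : Fin K → ℝ}
    (hℓ : ∀ k, ℓ k ∈ Set.Icc (0 : ℝ) 1) (k : Fin K) :
    ℓ k * (winProb (η • L) k -
        winProb (η • (L + Pi.single k (ℓ k / exploreProb 3 η L σ k))) k) ≤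
      9 * rankConst * η * (K : ℝ) ^ (1 / 3 : ℝ) *
        score (fun k => η * lossGap L k) σ k ^ 2 := by
  have : Nonempty (Fin K) := ⟨k⟩
  set g : Fin K → ℝ := fun k => η * lossGap L k with hg
  have hg0 : ∀ j, 0 ≤ g j := fun j => mul_nonneg hη.le (lossGap_nonneg L j)
  have hgz : ∃ j, g j = 0 := by
    obtain ⟨j, hj⟩ := exists_lossGap_eq_zero L
    exact ⟨j, by simp [hg, hj]⟩
  have hs := score_pos hg0 σ
  set S := ∑ j, score g σ j ^ 2 with hS
  have hS3 : S ≤ 3 * (K : ℝ) ^ (1 / 3 : ℝ) := sum_score_sq_le hg0 σ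
  have hS0 : 0 ≤ S := Finset.sum_nonneg fun j _ => sq_nonneg _
  have hR := one_le_rankConst
  obtain ⟨h0, h1⟩ := hℓ k
  rw [winProb_smul, winProb_smul_add_single, exploreProb_eq]
  have hδ : 0 ≤ η * (ℓ k / (score g σ k ^ 2 / S)) := by positivity
  have hw := winProb_sub_le_score hK g hg0 hgz σ (hσ.smul_lossGap hη) k hδ
  have hk := hs k
  calc _ ≤ 1 * (3 * rankConst * (η * (ℓ k / (score g σ k ^ 2 / S))) * score g σ k ^ 4) := by
        refine mul_le_mul h1 hw (sub_nonneg.2 (winProb_add_single_le g k hδ)) zero_le_one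
    _ = 3 * rankConst * η * S * score g σ k ^ 2 * ℓ k := by field_simp
    _ ≤ 3 * rankConst * η * S * score g σ k ^ 2 * 1 := by gcongr
    _ ≤ 3 * rankConst * η * (3 * (K : ℝ) ^ (1 / 3 : ℝ)) * score g σ k ^ 2 * 1 := by gcongr
    _ = _ := by ring

lemma stability_le (hK : 2 ≤ K) {η : ℝ} (hη : 0 < η) {L : Fin K → ℝ}
    {σ : Equiv.Perm (Fin K)} (hσ : IsRanking L σ) {ℓ : Fin K → ℝ}
    (hℓ : ∀ k, ℓ k ∈ Set.Icc (0 : ℝ) 1) :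
    stability η L σ ℓ ≤ 27 * rankConst * η * ((K : ℝ) ^ (1 / 3 : ℝ)) ^ 2 := by
  have hR := one_le_rankConst
  refine (Finset.sum_le_sum fun k _ => stability_term_le hK hη hσ hℓ k).trans ?_
  rw [← Finset.mul_sum]
  have := sum_score_sq_le (fun j => mul_nonneg hη.le (lossGap_nonneg L j)) σ
  calc _ ≤ 9 * rankConst * η * (K : ℝ) ^ (1 / 3 : ℝ) * (3 * (K : ℝ) ^ (1 / 3 : ℝ)) := by gcongr
    _ = _ := by ring

/-- At a leader of score 1, `stability_term_le` has no small factor. Its exploration probability is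
however at least 1/(3K^(1/3)), so the scaled update is at most 3ηK^(1/3) ≤ 1/2, as
`winProb_sub_le_leader` requires. -/
lemma stability_leader_le (hK : 2 ≤ K) {η : ℝ} (hη : 0 < η)
    (hηK : 6 * η * (K : ℝ) ^ (1 / 3 : ℝ) ≤ 1) {L : Fin K → ℝ}
    {σ : Equiv.Perm (Fin K)} {ℓ : Fin K → ℝ} {b : Fin K} (hgb : η * lossGap L b = 0)
    (hsb : score (fun k => η * lossGap L k) σ b = 1) (hℓ : ℓ b ∈ Set.Icc (0 : ℝ) 1) :
    ℓ b * (winProb (η • L) b -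
        winProb (η • (L + Pi.single b (ℓ b / exploreProb 3 η L σ b))) b) ≤
      72 * η * (K : ℝ) ^ (1 / 3 : ℝ) *
        ∑ j ∈ Finset.univ.erase b, ((1 + η * lossGap L j) ^ 3)⁻¹ := by
  obtain ⟨h0, h1⟩ := hℓ
  have hg0 : ∀ j, 0 ≤ η * lossGap L j := fun j => mul_nonneg hη.le (lossGap_nonneg L j)
  rw [winProb_smul, winProb_smul_add_single, exploreProb_eq, hsb]
  have hS3 := sum_score_sq_le hg0 σ
  set S := ∑ j, score (fun k => η * lossGap L k) σ j ^ 2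
  have hS0 : 0 ≤ S := Finset.sum_nonneg fun j _ => sq_nonneg _
  set κ := (K : ℝ) ^ (1 / 3 : ℝ)
  set δ := η * (ℓ b / (1 ^ 2 / S)) with hδ
  have hδ1 : δ = η * ℓ b * S := by
    rw [hδ, one_pow, div_div_eq_mul_div, div_one, mul_assoc]
  have hδ0 : 0 ≤ δ := by rw [hδ1]; positivity
  have hδ3 : δ ≤ 3 * η * κ := by
    rw [hδ1]
    calc η * ℓ b * S ≤ η * 1 * (3 * κ) := by gcongr
      _ = _ := by ring
  have hw := winProb_sub_le_leader hK _ hg0 b hgb hδ0 (by linarith)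
  set y := ∑ j ∈ Finset.univ.erase b, ((1 + η * lossGap L j) ^ 3)⁻¹
  have hy0 : 0 ≤ y := Finset.sum_nonneg fun j _ => by have := hg0 j; positivity
  have hd := sub_nonneg.2 (winProb_add_single_le (fun k => η * lossGap L k) b hδ0)
  refine (mul_le_of_le_one_left hd h1).trans (hw.trans ?_)
  refine mul_le_mul_of_nonneg_right ?_ hy0
  linarith

/-- If b loses with probability at least 1/11, the worst-case bound is already of the required
order. Otherwise b is forced to be the unique leader and the mass of the other arms is at most 11
times that probability. -/
lemma stability_le_self_bounding (hK : 2 ≤ K) {η a : ℝ} (hη : 0 < η) (ha : 1 ≤ a)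
    (hηK : 6 * η * (K : ℝ) ^ (1 / 3 : ℝ) ≤ 1) {L : Fin K → ℝ}
    {σ : Equiv.Perm (Fin K)} (hσ : IsRanking L σ) {ℓ : Fin K → ℝ}
    (hℓ : ∀ k, ℓ k ∈ Set.Icc (0 : ℝ) 1) (b : Fin K) :
    stability η L σ ℓ ≤ 900 * rankConst * η * (K : ℝ) ^ (1 / 3 : ℝ) *
      (a * (1 - winProb (η • L) b) + K / a ^ 2) := by
  have hR := one_le_rankConst
  have ha0 : 0 < a := by linarith
  set κ := (K : ℝ) ^ (1 / 3 : ℝ) with hκ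
  have hκ0 : 0 ≤ κ := by positivity
  have hκ3 : κ ^ 3 = K := by
    rw [hκ, ← Real.rpow_natCast, ← Real.rpow_mul (by positivity)]; norm_num
  set x := 1 - winProb (η • L) b with hx
  have hx0 : 0 ≤ x := sub_nonneg.2 (winProb_le_one _ _)
  have hKa : 0 ≤ (K : ℝ) / a ^ 2 := by positivity
  set g : Fin K → ℝ := fun k => η * lossGap L k with hg
  have hg0 : ∀ j, 0 ≤ g j := fun j => mul_nonneg hη.le (lossGap_nonneg L j)
  have hmass := min_one_mass_le g hg0 b
  rw [← winProb_smul, ← hx] at hmass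
  set y := ∑ j ∈ Finset.univ.erase b, ((1 + g j) ^ 3)⁻¹ with hy
  rcases le_or_gt 1 (11 * x) with h | h
  · refine (stability_le hK hη hσ hℓ).trans ?_
    -- For κ ≤ a the first term suffices, as 11x ≥ 1; for a ≤ κ the second does, as K = κ³.
    have h1 : κ ≤ 11 * (a * x) + K / a ^ 2 := by
      rcases le_total κ a with h' | h'
      · nlinarith
      · have : κ ≤ K / a ^ 2 := by
          rw [le_div_iff₀ (by positivity), ← hκ3]
          calc κ * a ^ 2 ≤ κ * κ ^ 2 := by gcongr
            _ = κ ^ 3 := by ring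
        nlinarith [mul_nonneg ha0.le hx0]
    calc 27 * rankConst * η * κ ^ 2 = 27 * rankConst * η * κ * κ := by ring
      _ ≤ 27 * rankConst * η * κ * (11 * (a * x) + K / a ^ 2) := by gcongr
      _ ≤ 27 * rankConst * η * κ * (100 / 3 * (a * x + K / a ^ 2)) := by
          refine mul_le_mul_of_nonneg_left ?_ (by positivity)
          nlinarith [mul_nonneg ha0.le hx0]
      _ = _ := by ring
  · have hy1 : y ≤ 11 * x := (min_le_iff.1 hmass).resolve_left (not_le.2 h)
    -- An arm of gap zero would contribute 1 to y, but y ≤ 11x < 1.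
    have hpos : ∀ j, j ≠ b → 0 < g j := by
      intro j hj
      refine lt_of_le_of_ne (hg0 j) fun h0 => ?_
      have := Finset.single_le_sum (f := fun j => ((1 + g j) ^ 3)⁻¹)
        (fun j _ => by have := hg0 j; positivity)
        (Finset.mem_erase.2 ⟨hj, Finset.mem_univ j⟩)
      simp only [← h0, add_zero, one_pow, inv_one, ← hy] at this
      linarith
    have : Nonempty (Fin K) := ⟨b⟩
    have hgb : g b = 0 := by
      obtain ⟨j, hj⟩ := exists_lossGap_eq_zero L
      have hj' : g j = 0 := by simp [hg, hj]
      by_cases hjb : j = b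
      · rwa [← hjb]
      · exact absurd hj' (hpos j hjb).ne'
    have hσb : (σ b : ℕ) = 0 := by
      have : NeZero K := ⟨by omega⟩
      by_contra hne
      have hkb : σ.symm 0 ≠ b := by
        rintro rfl; simp at hne
      have hlt := hσ.smul_lossGap hη b (σ.symm 0) (by
        change g b < g _; rw [hgb]; exact hpos _ hkb)
      simp at hlt
    have hsb : score g σ b = 1 := by simp [score, hgb, hσb]
    rw [stability, ← Finset.add_sum_erase _ _ (Finset.mem_univ b)]
    have hleader : ℓ b * (winProb (η • L) b -
        winProb (η • (L + Pi.single b (ℓ b / exploreProb 3 η L σ b))) b) ≤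
          792 * η * κ * (a * x) := by
      refine (stability_leader_le hK hη hηK hgb hsb (hℓ b)).trans ?_
      calc 72 * η * κ * y ≤ 72 * η * κ * (11 * (1 * x)) := by gcongr; linarith
        _ ≤ 72 * η * κ * (11 * (a * x)) := by gcongr
        _ = _ := by ring
    have hothers : ∑ k ∈ Finset.univ.erase b, ℓ k * (winProb (η • L) k -
        winProb (η • (L + Pi.single k (ℓ k / exploreProb 3 η L σ k))) k) ≤
          9 * rankConst * η * κ * (11 * (a * x) + K / a ^ 2) := by
      refine (Finset.sum_le_sum fun k _ => stability_term_le hK hη hσ hℓ k).trans ?_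
      rw [← Finset.mul_sum]
      refine mul_le_mul_of_nonneg_left ?_ (by positivity)
      calc ∑ k ∈ Finset.univ.erase b, score g σ k ^ 2
          ≤ ∑ k ∈ Finset.univ.erase b, (a * ((1 + g k) ^ 3)⁻¹ + 1 / a ^ 2) := by
            refine Finset.sum_le_sum fun k _ => ?_
            have hs := (score_pos hg0 σ k).le
            refine (sq_le_mul_cube_add hs ha0).trans ?_
            have : score g σ k ^ 3 ≤ ((1 + g k) ^ 3)⁻¹ := by
              rw [← inv_pow, ← one_div]
              exact pow_le_pow_left₀ hs (min_le_left _ _) 3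
            gcongr
        _ ≤ a * y + K * (1 / a ^ 2) := by
            rw [Finset.sum_add_distrib, ← Finset.mul_sum, Finset.sum_const, nsmul_eq_mul]
            gcongr
            exact (Finset.card_le_univ _).trans (by simp)
        _ ≤ a * (11 * x) + K * (1 / a ^ 2) := by gcongr
        _ = _ := by ring
    have hax := mul_nonneg ha0.le hx0
    calc _ ≤ 792 * η * κ * (a * x) + 9 * rankConst * η * κ * (11 * (a * x) + K / a ^ 2) :=
          add_le_add hleader hothers
      _ ≤ 792 * rankConst * η * κ * (a * x) +
          9 * rankConst * η * κ * (11 * (a * x) + K / a ^ 2) := by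
          gcongr
          nlinarith
      _ ≤ 792 * rankConst * η * κ * (a * x + K / a ^ 2) +
          9 * rankConst * η * κ * (12 * (a * x + K / a ^ 2)) := by
          gcongr <;> linarith
      _ = _ := by ring

end

/-! ### Ties, measurability and the laws of the exploited and explored arms -/

section

variable {K : ℕ}

/-- Given the other coordinates, a tie fixes the perturbation of k at one point, and the Pareto law
has no atoms. -/
lemma winProb_tie (g : Fin K → ℝ) {k k' : Fin K} (h : k ≠ k') :
    (perturbLaw K).real (winSet g k ∩ winSet g k') = 0 := by
  set A : Set (Fin K → ℝ) := {ρ | ρ k - g k = ρ k' - g k'} with hA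
  have hAm : MeasurableSet A := measurableSet_eq_fun (by fun_prop) (by fun_prop)
  have hsub : winSet g k ∩ winSet g k' ⊆ A := fun ρ hρ => le_antisymm (hρ.2 k) (hρ.1 k')
  refine le_antisymm ((measureReal_mono hsub).trans ?_) measureReal_nonneg
  rw [perturbLaw_real_eq_integral k hAm]
  have : ∀ x : Fin K → ℝ, {y | Function.update x k y ∈ A} = {x k' - g k' + g k} := by
    intro x; ext y
    simp only [hA, Set.mem_ofPred_eq, Function.update_self, Function.update_of_ne h.symm,
      Set.mem_singleton_iff]
    exact ⟨fun h => by linarith, fun h => by linarith⟩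
  simp [this, measureReal_def]

lemma measurable_lossGap {Ω' : Type*} {_ : MeasurableSpace Ω'} {L : Ω' → Fin K → ℝ}
    (hL : Measurable L) (k : Fin K) : Measurable fun ω => lossGap (L ω) k := by
  have h : ∀ i, Measurable fun ω => L ω i := fun i => (measurable_pi_apply i).comp hL
  exact (h k).sub (Measurable.iInf fun i => h i)

lemma measurable_score {Ω' : Type*} {_ : MeasurableSpace Ω'} {g : Ω' → Fin K → ℝ}
    (hg : Measurable g) {s : Ω' → Equiv.Perm (Fin K)} (hs : ∀ k, Measurable fun ω => s ω k)
    (k : Fin K) : Measurable fun ω => score (g ω) (s ω) k := by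
  have h : Measurable fun ω => g ω k := (measurable_pi_apply k).comp hg
  have hf : Measurable fun i : Fin K => (1 / ((i : ℕ) + 1 : ℝ) ^ (1 / 3 : ℝ)) := measurable_of_finite _
  exact (measurable_const.div (measurable_const.add h)).min (hf.comp (hs k))

lemma measurable_exploreProb {Ω' : Type*} {_ : MeasurableSpace Ω'} {L : Ω' → Fin K → ℝ}
    (hL : Measurable L) {s : Ω' → Equiv.Perm (Fin K)} (hs : ∀ k, Measurable fun ω => s ω k)
    (η : ℝ) (k : Fin K) : Measurable fun ω => exploreProb 3 η (L ω) (s ω) k := by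
  have hg : Measurable fun ω => fun k => η * lossGap (L ω) k :=
    measurable_pi_iff.2 fun k => (measurable_lossGap hL k).const_mul η
  have h : ∀ k, Measurable fun ω => score (fun k => η * lossGap (L ω) k) (s ω) k ^ 2 :=
    fun k => (measurable_score hg hs k).pow_const 2
  simp only [exploreProb_eq]
  exact (h k).div (Finset.measurable_fun_sum _ fun k _ => h k)

lemma exploreProb_pos {η : ℝ} (hη : 0 < η) (L : Fin K → ℝ) (s : Equiv.Perm (Fin K)) (k : Fin K) :
    0 < exploreProb 3 η L s k := by
  have hs := score_pos (fun j => mul_nonneg hη.le (lossGap_nonneg L j)) s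
  rw [exploreProb_eq]
  exact div_pos (pow_pos (hs k) 2)
    (Finset.sum_pos (fun j _ => pow_pos (hs j) 2) ⟨k, Finset.mem_univ k⟩)

/-- Deliberately crude: it only serves to make all estimates bounded, hence integrable, at each
fixed round. -/
lemma inv_exploreProb_le {η B : ℝ} (hη : 0 < η) {L : Fin K → ℝ} (hL : ∀ k, 0 ≤ L k)
    (hB : ∀ k, L k ≤ B) (s : Equiv.Perm (Fin K)) (k : Fin K) :
    1 / exploreProb 3 η L s k ≤ K * ((1 + η * B) * K) ^ 2 := by
  have : Nonempty (Fin K) := ⟨k⟩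
  have hK1 : (1 : ℝ) ≤ K := by
    have : 1 ≤ K := by have := k.pos; omega
    exact_mod_cast this
  have hg0 : ∀ j, 0 ≤ η * lossGap L j := fun j => mul_nonneg hη.le (lossGap_nonneg L j)
  have hs := score_pos hg0 s
  have hB0 : 0 ≤ B := (hL k).trans (hB k)
  have hηB : 0 ≤ η * B := mul_nonneg hη.le hB0
  have hgB : η * lossGap L k ≤ η * B := by
    refine mul_le_mul_of_nonneg_left ?_ hη.le
    have : 0 ≤ ⨅ j, L j := le_ciInf hL
    have := hB k
    unfold lossGap
    linarith
  have hsum : ∑ j, score (fun k => η * lossGap L k) s j ^ 2 ≤ K := by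
    calc _ ≤ ∑ _ : Fin K, (1 : ℝ) := Finset.sum_le_sum fun j _ => by
          refine pow_le_one₀ (hs j).le ((min_le_left _ _).trans ?_)
          have := hg0 j
          rw [div_le_one (by positivity)]; linarith
      _ = K := by simp
  have hlow : 1 / ((1 + η * B) * K) ≤ score (fun k => η * lossGap L k) s k := by
    refine le_min ?_ ?_
    · have := hg0 k
      refine one_div_le_one_div_of_le (by positivity) ?_
      nlinarith
    · refine one_div_le_one_div_of_le (by positivity) ?_
      have h1 : ((s k : ℕ) + 1 : ℝ) ≤ K := by exact_mod_cast (s k).isLt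
      calc ((s k : ℕ) + 1 : ℝ) ^ (1 / 3 : ℝ) ≤ ((s k : ℕ) + 1 : ℝ) ^ (1 : ℝ) :=
            Real.rpow_le_rpow_of_exponent_le (by linarith [Nat.cast_nonneg (α := ℝ) (s k : ℕ)])
              (by norm_num)
        _ ≤ 1 * K := by rw [Real.rpow_one]; linarith
        _ ≤ _ := by gcongr; linarith
  have hpos : 0 < (1 + η * B) * (K : ℝ) := by positivity
  rw [exploreProb_eq, one_div_div]
  have hk := hs k
  rw [div_le_iff₀ (by positivity)]
  have h1 : 1 ≤ (1 + η * B) * K * score (fun k => η * lossGap L k) s k := by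
    rw [div_le_iff₀ hpos] at hlow; linarith
  have h2 := one_le_pow₀ (n := 2) h1
  calc _ ≤ (K : ℝ) * 1 := by linarith
    _ ≤ K * ((1 + η * B) * K * score (fun k => η * lossGap L k) s k) ^ 2 := by gcongr
    _ = _ := by ring

lemma exists_estLoss_bound {η : ℕ → ℝ} (hη : ∀ t, 0 < η t) (K t : ℕ) :
    ∃ B : ℝ, ∀ (ℓ : ℕ → Fin K → ℝ) (s : ℕ → Equiv.Perm (Fin K)) (j : ℕ → Fin K),
      (∀ u < t, ∀ k, ℓ u k ∈ Set.Icc (0 : ℝ) 1) →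
      ∀ k, estLoss 3 η ℓ s j t k ∈ Set.Icc (0 : ℝ) B := by
  induction t with
  | zero => exact ⟨0, fun ℓ s j _ k => by simp [estLoss]⟩
  | succ t ih =>
    obtain ⟨B, hB⟩ := ih
    refine ⟨B + K * ((1 + η t * B) * K) ^ 2, fun ℓ s j h k => ?_⟩
    have ih := hB ℓ s j fun u hu => h u (by omega)
    have hp := exploreProb_pos (hη t) (estLoss 3 η ℓ s j t) (s t) k
    have hle := inv_exploreProb_le (hη t) (fun k => (ih k).1) (fun k => (ih k).2) (s t) k
    obtain ⟨h0, h1⟩ := h t (by omega) k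
    have hinv : 0 ≤ 1 / exploreProb 3 (η t) (estLoss 3 η ℓ s j t) (s t) k := by positivity
    simp only [estLoss, Pi.add_apply]
    by_cases hk : k = j t
    · subst hk
      rw [Pi.single_eq_same]
      have hv : ℓ t (j t) / exploreProb 3 (η t) (estLoss 3 η ℓ s j t) (s t) (j t) ≤
          1 / exploreProb 3 (η t) (estLoss 3 η ℓ s j t) (s t) (j t) := by gcongr
      exact ⟨add_nonneg (ih _).1 (by positivity), add_le_add (ih _).2 (hv.trans hle)⟩
    · rw [Pi.single_eq_of_ne hk, add_zero]
      exact ⟨(ih k).1, by linarith [(ih k).2]⟩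

lemma measurable_coord {Ω' : Type*} {_ : MeasurableSpace Ω'} {X : Ω' → Fin K → ℝ}
    (hX : Measurable X) (k : Fin K) : Measurable fun ω => X ω k :=
  (measurable_pi_apply k).comp hX

lemma measurable_of_coord {Ω' : Type*} {_ : MeasurableSpace Ω'} {X : Ω' → Fin K → ℝ}
    (hX : ∀ k, Measurable fun ω => X ω k) : Measurable X :=
  measurable_pi_iff.2 hX

lemma integrable_of_abs_le {Ω : Type*} {m : MeasurableSpace Ω} {μ : Measure Ω}
    [IsProbabilityMeasure μ] {f : Ω → ℝ} (hf : Measurable f) {C : ℝ} (h : ∀ ω, |f ω| ≤ C) :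
    Integrable f μ :=
  Integrable.of_bound hf.aestronglyMeasurable C (ae_of_all _ h)

/-- Integrating out a perturbation that is independent of everything else. -/
lemma integral_mul_indicator_of_indep {Ω : Type*} {G m : MeasurableSpace Ω} {μ : Measure Ω}
    [IsProbabilityMeasure μ] (hG : G ≤ m)
    {r : Ω → Fin K → ℝ} (hr : Measurable r) (hlaw : μ.map r = perturbLaw K)
    (hind : Indep (MeasurableSpace.comap r inferInstance) G μ)
    {X : Ω → Fin K → ℝ} (hX : Measurable[G] X) {h : Ω → ℝ} (hh : Measurable[G] h) {C : ℝ}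
    (hC : ∀ ω, |h ω| ≤ C) {P : Set ((Fin K → ℝ) × (Fin K → ℝ))} (hP : MeasurableSet P) :
    ∫ ω, h ω * P.indicator (fun _ => (1 : ℝ)) (X ω, r ω) ∂μ =
      ∫ ω, h ω * (perturbLaw K).real {ρ | (X ω, ρ) ∈ P} ∂μ := by
  have hX' : Measurable X := hX.mono hG le_rfl
  have hh' : Measurable h := hh.mono hG le_rfl
  have hXh : Measurable fun ω => (X ω, h ω) := hX'.prodMk hh'
  have hindep : IndepFun (fun ω => (X ω, h ω)) r μ := by
    rw [IndepFun_iff_Indep]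
    refine indep_of_indep_of_le_left hind.symm ?_
    exact (hX.prodMk hh).comap_le
  have hmap := (indepFun_iff_map_prod_eq_prod_map_map hXh.aemeasurable hr.aemeasurable).1 hindep
  rw [hlaw] at hmap
  set F : ((Fin K → ℝ) × ℝ) × (Fin K → ℝ) → ℝ := fun p =>
    p.1.2 * P.indicator (fun _ => (1 : ℝ)) (p.1.1, p.2) with hF
  have hFm : Measurable F := by
    refine measurable_fst.snd.mul ?_
    exact (measurable_const.indicator hP).comp (measurable_fst.fst.prodMk measurable_snd)
  have hpm : Measurable fun ω => ((X ω, h ω), r ω) := hXh.prodMk hr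
  have hFi : Integrable F ((μ.map fun ω => (X ω, h ω)).prod (perturbLaw K)) := by
    rw [← hmap, integrable_map_measure hFm.aestronglyMeasurable hpm.aemeasurable]
    refine integrable_of_abs_le (hFm.comp hpm) (C := C) fun ω => ?_
    have h0 := (abs_nonneg _).trans (hC ω)
    simp only [hF, Function.comp, abs_mul]
    by_cases hω : (X ω, r ω) ∈ P
    · simpa [hω] using hC ω
    · simpa [hω] using h0
  have h1 : ∫ ω, F ((X ω, h ω), r ω) ∂μ = ∫ p, F p ∂(μ.map fun ω => ((X ω, h ω), r ω)) :=
    (integral_map hpm.aemeasurable hFm.aestronglyMeasurable).symm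
  change ∫ ω, F ((X ω, h ω), r ω) ∂μ = _
  rw [h1, hmap, integral_prod F hFi]
  have h2 : ∀ q : (Fin K → ℝ) × ℝ, ∫ ρ, F (q, ρ) ∂perturbLaw K =
      q.2 * (perturbLaw K).real {ρ | (q.1, ρ) ∈ P} := by
    intro q
    simp only [hF]
    rw [integral_const_mul]
    congr 1
    have : (fun ρ => P.indicator (fun _ => (1 : ℝ)) (q.1, ρ)) =
        {ρ | (q.1, ρ) ∈ P}.indicator fun _ => (1 : ℝ) := by ext ρ; rfl
    have hm : MeasurableSet {ρ | (q.1, ρ) ∈ P} := measurable_prodMk_left hP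
    rw [this, integral_indicator hm]
    simp
  simp only [h2]
  rw [integral_map hXh.aemeasurable]
  refine (measurable_snd.mul ?_).aestronglyMeasurable
  exact ((measurable_measure_prodMk_left hP).ennreal_toReal).comp measurable_fst

lemma integral_mul_of_condExp {Ω : Type*} {H m : MeasurableSpace Ω} {μ : Measure Ω}
    [IsProbabilityMeasure μ] (hH : H ≤ m) {Y p f : Ω → ℝ} (hY : Integrable Y μ)
    (hp : μ[Y | H] =ᵐ[μ] p) (hf : Measurable[H] f) {C : ℝ} (hC : ∀ ω, |f ω| ≤ C) :
    ∫ ω, Y ω * f ω ∂μ = ∫ ω, p ω * f ω ∂μ := by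
  have hif : Integrable (Y * f) μ :=
    hY.mul_bdd (c := C) (hf.mono hH le_rfl).aestronglyMeasurable (ae_of_all _ hC)
  have h1 := condExp_mul_of_stronglyMeasurable_right (m := H) hf.stronglyMeasurable hif hY
  change ∫ ω, (Y * f) ω ∂μ = _
  rw [← integral_condExp hH]
  refine integral_congr_ae ?_
  filter_upwards [h1, hp] with ω h2 h3
  rw [h2, Pi.mul_apply, h3]

/-- The estimated losses along a run with shape `3`. -/
def runLoss {Ω : Type*} (η : ℕ → ℝ) (ℓ : ℕ → Ω → Fin K → ℝ) (σ : ℕ → Ω → Equiv.Perm (Fin K))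
    (j : ℕ → Ω → Fin K) (t : ℕ) (ω : Ω) : Fin K → ℝ :=
  estLoss 3 η (fun s => ℓ s ω) (fun s => σ s ω) (fun s => j s ω) t

variable {Ω : Type*} [m : MeasurableSpace Ω] {μ : Measure Ω} {η : ℕ → ℝ} {T : ℕ} {ℱ : Filtration ℕ m} {ℓ r : ℕ → Ω → Fin K → ℝ}
  {σ : ℕ → Ω → Equiv.Perm (Fin K)} {i j : ℕ → Ω → Fin K}

/-- The history at the beginning of a round together with the losses of the round. -/
abbrev lossHistory (ℱ : Filtration ℕ m) (ℓ : ℕ → Ω → Fin K → ℝ) (t : ℕ) : MeasurableSpace Ω :=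
  ℱ t ⊔ MeasurableSpace.comap (ℓ t) inferInstance

lemma measurable_loss_lossHistory (ℱ : Filtration ℕ m) (ℓ : ℕ → Ω → Fin K → ℝ) (t : ℕ)
    (k : Fin K) : Measurable[lossHistory ℱ ℓ t] fun ω => ℓ t ω k :=
  (measurable_pi_apply k).comp ((comap_measurable (ℓ t)).mono le_sup_right le_rfl)

namespace IsRun

lemma measurable_runLoss (h : IsRun μ 3 η T ℱ ℓ r σ i j) {t : ℕ} (ht : t ≤ T) :
    Measurable[ℱ t] (runLoss η ℓ σ j t) := by
  induction t with
  | zero => exact measurable_const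
  | succ t ih =>
    have ht' : t < T := ht
    have hle : ℱ t ≤ ℱ (t + 1) := ℱ.mono (Nat.le_succ t)
    have hL := (ih ht'.le).mono hle le_rfl
    refine measurable_of_coord fun k => ?_
    have hLk := measurable_coord hL k
    have hℓk := measurable_coord (h.measurable_loss t ht') k
    have hpk := measurable_exploreProb hL (fun k => (h.measurable_rank t ht' k).mono hle le_rfl)
      (η t) k
    have hj : MeasurableSet[ℱ (t + 1)] {ω | j t ω = k} :=
      h.measurable_explore t ht' (measurableSet_singleton k)
    have : (fun ω => runLoss η ℓ σ j (t + 1) ω k) = fun ω => runLoss η ℓ σ j t ω k +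
        {ω | j t ω = k}.indicator
          (fun ω => ℓ t ω k / exploreProb 3 (η t) (runLoss η ℓ σ j t ω) (σ t ω) k) ω := by
      ext ω
      simp only [runLoss, estLoss, Pi.add_apply]
      by_cases hk : j t ω = k
      · subst hk
        rw [Pi.single_eq_same, Set.indicator_of_mem (by rfl)]
      · rw [Pi.single_eq_of_ne (Ne.symm hk), Set.indicator_of_notMem (by exact hk)]
    rw [this]
    exact hLk.add ((hℓk.div hpk).indicator hj)

lemma lossHistory_le (h : IsRun μ 3 η T ℱ ℓ r σ i j) {t : ℕ} (ht : t < T) :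
    lossHistory ℱ ℓ t ≤ m :=
  sup_le (ℱ.le t) ((h.measurable_loss t ht).mono (ℱ.le _) le_rfl).comap_le

lemma measurable_runLoss_lossHistory (h : IsRun μ 3 η T ℱ ℓ r σ i j) {t : ℕ} (ht : t < T) :
    Measurable[lossHistory ℱ ℓ t] (runLoss η ℓ σ j t) :=
  (h.measurable_runLoss ht.le).mono le_sup_left le_rfl

lemma measurable_exploreProb (h : IsRun μ 3 η T ℱ ℓ r σ i j) {t : ℕ} (ht : t < T) (k : Fin K) :
    Measurable[lossHistory ℱ ℓ t] fun ω =>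
      exploreProb 3 (η t) (runLoss η ℓ σ j t ω) (σ t ω) k :=
  DecoupledBandit.measurable_exploreProb (h.measurable_runLoss_lossHistory ht)
    (fun k => (h.measurable_rank t ht k).mono le_sup_left le_rfl) (η t) k

lemma measurable_winProb_runLoss (h : IsRun μ 3 η T ℱ ℓ r σ i j) {t : ℕ} (ht : t < T) (k : Fin K) :
    Measurable[ℱ t] fun ω => winProb (η t • runLoss η ℓ σ j t ω) k :=
  (measurable_winProb k).comp ((h.measurable_runLoss ht.le).const_smul (η t))

/-- The law of the explored arm. -/
lemma integral_explore [IsProbabilityMeasure μ] (h : IsRun μ 3 η T ℱ ℓ r σ i j) {t : ℕ} (ht : t < T) (k : Fin K)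
    {f : Ω → ℝ} (hf : Measurable[lossHistory ℱ ℓ t] f) {C : ℝ} (hC : ∀ ω, |f ω| ≤ C) :
    ∫ ω, {ω | j t ω = k}.indicator (fun _ => (1 : ℝ)) ω * f ω ∂μ =
      ∫ ω, exploreProb 3 (η t) (runLoss η ℓ σ j t ω) (σ t ω) k * f ω ∂μ := by
  have hr : MeasurableSpace.comap (r t) inferInstance ≤ m :=
    ((h.measurable_perturbation t ht).mono (ℱ.le _) le_rfl).comap_le
  exact integral_mul_of_condExp (sup_le (h.lossHistory_le ht) hr)
    ((integrable_const _).indicator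
      (((h.measurable_explore t ht).mono (ℱ.le _) le_rfl) (measurableSet_singleton k)))
    (h.explore t ht k) (hf.mono le_sup_left le_rfl) hC

lemma integral_mul_indicator_perturbation [IsProbabilityMeasure μ] (h : IsRun μ 3 η T ℱ ℓ r σ i j) {t : ℕ} (ht : t < T)
    {f : Ω → ℝ} (hf : Measurable[lossHistory ℱ ℓ t] f) {C : ℝ} (hC : ∀ ω, |f ω| ≤ C)
    {P : Set ((Fin K → ℝ) × (Fin K → ℝ))} (hP : MeasurableSet P) :
    ∫ ω, f ω * P.indicator (fun _ => (1 : ℝ)) (η t • runLoss η ℓ σ j t ω, r t ω) ∂μ =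
      ∫ ω, f ω * (perturbLaw K).real {ρ | (η t • runLoss η ℓ σ j t ω, ρ) ∈ P} ∂μ :=
  integral_mul_indicator_of_indep (h.lossHistory_le ht)
    ((h.measurable_perturbation t ht).mono (ℱ.le _) le_rfl) (h.perturbation_law t ht)
    (h.perturbation_indep t ht) ((h.measurable_runLoss_lossHistory ht).const_smul (η t)) hf hC hP

lemma exploit_mem_winSet (h : IsRun μ 3 η T ℱ ℓ r σ i j) (hη : ∀ t, 0 < η t) {t : ℕ} (ht : t < T)
    (ω : Ω) : r t ω ∈ winSet (η t • runLoss η ℓ σ j t ω) (i t ω) :=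
  (mem_winSet_iff (hη t) _ _ _).2 (h.exploit t ht ω)

/-- The exploited arm always wins; conversely a winner is the exploited arm unless there is a tie,
which has probability zero by independence and `winProb_tie`. Tie-breaking is therefore immaterial.
-/
lemma ae_exploit_iff [IsProbabilityMeasure μ] (h : IsRun μ 3 η T ℱ ℓ r σ i j) (hη : ∀ t, 0 < η t) {t : ℕ} (ht : t < T)
    (k : Fin K) :
    ∀ᵐ ω ∂μ, i t ω = k ↔ r t ω ∈ winSet (η t • runLoss η ℓ σ j t ω) k := by
  have hnull : ∀ k' : Fin K, k ≠ k' → ∀ᵐ ω ∂μ,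
      ¬ (r t ω ∈ winSet (η t • runLoss η ℓ σ j t ω) k ∩
        winSet (η t • runLoss η ℓ σ j t ω) k') := by
    intro k' hk
    set P : Set ((Fin K → ℝ) × (Fin K → ℝ)) :=
      {p | p.2 ∈ winSet p.1 k} ∩ {p | p.2 ∈ winSet p.1 k'} with hP
    have hPm : MeasurableSet P :=
      (measurableSet_winSet_pair k).inter (measurableSet_winSet_pair k')
    have h1 := h.integral_mul_indicator_perturbation ht (f := fun _ => 1) measurable_const
      (C := 1) (by simp) hPm
    have h2 : ∀ ω, (perturbLaw K).real {ρ | (η t • runLoss η ℓ σ j t ω, ρ) ∈ P} = 0 :=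
      fun ω => winProb_tie _ hk
    simp only [h2, one_mul, integral_zero] at h1
    have hpm : Measurable fun ω => (η t • runLoss η ℓ σ j t ω, r t ω) :=
      (((h.measurable_runLoss ht.le).mono (ℱ.le _) le_rfl).const_smul (η t)).prodMk
        ((h.measurable_perturbation t ht).mono (ℱ.le _) le_rfl)
    have hA : MeasurableSet {ω | (η t • runLoss η ℓ σ j t ω, r t ω) ∈ P} := hpm hPm
    have h3 : (fun ω => P.indicator (fun _ => (1 : ℝ)) (η t • runLoss η ℓ σ j t ω, r t ω)) =
        {ω | (η t • runLoss η ℓ σ j t ω, r t ω) ∈ P}.indicator (fun _ => (1 : ℝ)) := by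
      ext ω; rfl
    rw [h3, integral_indicator hA] at h1
    simp only [integral_const, measureReal_restrict_apply_univ, smul_eq_mul, mul_one] at h1
    rw [measureReal_eq_zero_iff] at h1
    exact measure_eq_zero_iff_ae_notMem.1 h1
  have hall : ∀ᵐ ω ∂μ, ∀ k' : Fin K, k ≠ k' →
      ¬ (r t ω ∈ winSet (η t • runLoss η ℓ σ j t ω) k ∩
        winSet (η t • runLoss η ℓ σ j t ω) k') := by
    rw [ae_all_iff]
    intro k'
    by_cases hk : k = k'
    · simp [hk]
    · simpa [hk] using hnull k' hk
  filter_upwards [hall] with ω hω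
  constructor
  · rintro rfl
    exact h.exploit_mem_winSet hη ht ω
  · intro hk
    by_contra hne
    exact hω (i t ω) (Ne.symm hne) ⟨hk, h.exploit_mem_winSet hη ht ω⟩

/-- The law of the exploited arm. -/
lemma integral_exploit [IsProbabilityMeasure μ] (h : IsRun μ 3 η T ℱ ℓ r σ i j) (hη : ∀ t, 0 < η t) {t : ℕ} (ht : t < T)
    (k : Fin K) {f : Ω → ℝ} (hf : Measurable[lossHistory ℱ ℓ t] f) {C : ℝ}
    (hC : ∀ ω, |f ω| ≤ C) :
    ∫ ω, f ω * {ω | i t ω = k}.indicator (fun _ => (1 : ℝ)) ω ∂μ =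
      ∫ ω, f ω * winProb (η t • runLoss η ℓ σ j t ω) k ∂μ := by
  refine Eq.trans ?_ (h.integral_mul_indicator_perturbation ht hf hC (measurableSet_winSet_pair k))
  refine integral_congr_ae ?_
  filter_upwards [h.ae_exploit_iff hη ht k] with ω hω
  congr 1
  by_cases hk : i t ω = k
  · rw [Set.indicator_of_mem (by exact hk), Set.indicator_of_mem (by exact hω.1 hk)]
  · rw [Set.indicator_of_notMem (by exact hk),
      Set.indicator_of_notMem (by exact fun hc => hk (hω.2 hc))]

end IsRun

end

/-! ### Unbiased estimates and the decomposition of the exploited loss -/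

section

variable {K : ℕ}

lemma measurable_add_single {Ω' : Type*} {_ : MeasurableSpace Ω'} {X : Ω' → Fin K → ℝ}
    (hX : Measurable X) {v : Ω' → ℝ} (hv : Measurable v) (k : Fin K) :
    Measurable fun ω => X ω + Pi.single k (v ω) := by
  refine measurable_of_coord fun j => ?_
  by_cases h : j = k
  · subst h
    simp only [Pi.add_apply, Pi.single_eq_same]
    exact (measurable_coord hX j).add hv
  · simpa [h] using measurable_coord hX j

variable {Ω : Type*} {η : ℕ → ℝ} {T : ℕ} {ℓ r : ℕ → Ω → Fin K → ℝ}
  {σ : ℕ → Ω → Equiv.Perm (Fin K)} {i j : ℕ → Ω → Fin K}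

/-- The importance-weighted estimate of the loss of arm `k` in round `t`, were it explored. -/
def weightedLoss (η : ℕ → ℝ) (ℓ : ℕ → Ω → Fin K → ℝ) (σ : ℕ → Ω → Equiv.Perm (Fin K))
    (j : ℕ → Ω → Fin K) (t : ℕ) (k : Fin K) (ω : Ω) : ℝ :=
  ℓ t ω k / exploreProb 3 (η t) (runLoss η ℓ σ j t ω) (σ t ω) k

lemma runLoss_succ (η : ℕ → ℝ) (ℓ : ℕ → Ω → Fin K → ℝ) (σ : ℕ → Ω → Equiv.Perm (Fin K))
    (j : ℕ → Ω → Fin K) (t : ℕ) (ω : Ω) :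
    runLoss η ℓ σ j (t + 1) ω = runLoss η ℓ σ j t ω +
      Pi.single (j t ω) (weightedLoss η ℓ σ j t (j t ω) ω) := rfl

lemma exploreProb_mul_weightedLoss (hη : ∀ t, 0 < η t) (t : ℕ) (k : Fin K) (ω : Ω) :
    exploreProb 3 (η t) (runLoss η ℓ σ j t ω) (σ t ω) k * weightedLoss η ℓ σ j t k ω =
      ℓ t ω k :=
  mul_div_cancel₀ _ (exploreProb_pos (hη t) _ _ k).ne'

lemma exists_weightedLoss_bound (hη : ∀ t, 0 < η t)
    (hℓ : ∀ t < T, ∀ ω k, ℓ t ω k ∈ Set.Icc (0 : ℝ) 1) {t : ℕ} (ht : t < T) :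
    ∃ D, ∀ ω k, weightedLoss η ℓ σ j t k ω ∈ Set.Icc (0 : ℝ) D := by
  obtain ⟨B, hB⟩ := exists_estLoss_bound hη K t
  refine ⟨K * ((1 + η t * B) * K) ^ 2, fun ω k => ?_⟩
  have hL := hB (fun s => ℓ s ω) (fun s => σ s ω) (fun s => j s ω)
    fun u hu k => hℓ u (hu.trans ht) ω k
  have hp := exploreProb_pos (hη t) (runLoss η ℓ σ j t ω) (σ t ω) k
  obtain ⟨h0, h1⟩ := hℓ t ht ω k
  refine ⟨div_nonneg h0 hp.le, le_trans ?_ (inv_exploreProb_le (hη t) (fun k => (hL k).1)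
    (fun k => (hL k).2) (σ t ω) k)⟩
  exact div_le_div_of_nonneg_right h1 hp.le

variable [m : MeasurableSpace Ω] {μ : Measure Ω} {ℱ : Filtration ℕ m}

namespace IsRun

lemma integral_apply_exploit [IsProbabilityMeasure μ] (h : IsRun μ 3 η T ℱ ℓ r σ i j)
    (hη : ∀ t, 0 < η t) {t : ℕ} (ht : t < T) {f : Fin K → Ω → ℝ}
    (hf : ∀ k, Measurable[lossHistory ℱ ℓ t] (f k)) {C : ℝ} (hC : ∀ k ω, |f k ω| ≤ C) :
    ∫ ω, f (i t ω) ω ∂μ =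
      ∑ k, ∫ ω, f k ω * winProb (η t • runLoss η ℓ σ j t ω) k ∂μ := by
  have hi : ∀ k, MeasurableSet {ω | i t ω = k} := fun k =>
    ((h.measurable_exploit t ht).mono (ℱ.le _) le_rfl) (measurableSet_singleton k)
  have hint : ∀ k ∈ Finset.univ, Integrable
      (fun ω => f k ω * {ω | i t ω = k}.indicator (fun _ => (1 : ℝ)) ω) μ := fun k _ =>
    ((integrable_const (1 : ℝ)).indicator (hi k)).bdd_mul (c := C)
      ((hf k).mono (h.lossHistory_le ht) le_rfl).aestronglyMeasurable (ae_of_all _ (hC k))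
  have : ∀ ω, f (i t ω) ω =
      ∑ k, f k ω * {ω | i t ω = k}.indicator (fun _ => (1 : ℝ)) ω := by
    intro ω
    rw [Finset.sum_eq_single (i t ω)]
    · simp
    · intro k _ hk
      rw [Set.indicator_of_notMem (by exact hk.symm), mul_zero]
    · simp
  simp only [this]
  rw [integral_finsetSum _ hint]
  exact Finset.sum_congr rfl fun k _ => h.integral_exploit hη ht k (hf k) (hC k)

lemma integral_apply_explore [IsProbabilityMeasure μ] (h : IsRun μ 3 η T ℱ ℓ r σ i j)
    {t : ℕ} (ht : t < T) {f : Fin K → Ω → ℝ}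
    (hf : ∀ k, Measurable[lossHistory ℱ ℓ t] (f k)) {C : ℝ} (hC : ∀ k ω, |f k ω| ≤ C) :
    ∫ ω, f (j t ω) ω ∂μ =
      ∑ k, ∫ ω, exploreProb 3 (η t) (runLoss η ℓ σ j t ω) (σ t ω) k * f k ω ∂μ := by
  have hj : ∀ k, MeasurableSet {ω | j t ω = k} := fun k =>
    ((h.measurable_explore t ht).mono (ℱ.le _) le_rfl) (measurableSet_singleton k)
  have hint : ∀ k ∈ Finset.univ, Integrable
      (fun ω => {ω | j t ω = k}.indicator (fun _ => (1 : ℝ)) ω * f k ω) μ := fun k _ =>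
    ((integrable_const (1 : ℝ)).indicator (hj k)).mul_bdd (c := C)
      ((hf k).mono (h.lossHistory_le ht) le_rfl).aestronglyMeasurable (ae_of_all _ (hC k))
  have : ∀ ω, f (j t ω) ω =
      ∑ k, {ω | j t ω = k}.indicator (fun _ => (1 : ℝ)) ω * f k ω := by
    intro ω
    rw [Finset.sum_eq_single (j t ω)]
    · simp
    · intro k _ hk
      rw [Set.indicator_of_notMem (by exact hk.symm), zero_mul]
    · simp
  simp only [this]
  rw [integral_finsetSum _ hint]
  exact Finset.sum_congr rfl fun k _ => h.integral_explore ht k (hf k) (hC k)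

lemma measurable_weightedLoss (h : IsRun μ 3 η T ℱ ℓ r σ i j) {t : ℕ} (ht : t < T) (k : Fin K) :
    Measurable[lossHistory ℱ ℓ t] (weightedLoss η ℓ σ j t k) :=
  (measurable_loss_lossHistory ℱ ℓ t k).div (h.measurable_exploreProb ht k)

lemma measurable_winProb_add (h : IsRun μ 3 η T ℱ ℓ r σ i j) {t : ℕ} (ht : t < T) (k : Fin K) :
    Measurable[lossHistory ℱ ℓ t] fun ω => winProb (η t • (runLoss η ℓ σ j t ω +
      Pi.single k (weightedLoss η ℓ σ j t k ω))) k :=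
  (measurable_winProb k).comp ((measurable_add_single (h.measurable_runLoss_lossHistory ht)
    (h.measurable_weightedLoss ht k) k).const_smul (η t))

/-- The exploited loss splits into the stability and the loss at the updated winning
probabilities. -/
lemma integral_exploited_loss [IsProbabilityMeasure μ] (h : IsRun μ 3 η T ℱ ℓ r σ i j)
    (hη : ∀ t, 0 < η t) (hℓ : ∀ t < T, ∀ ω k, ℓ t ω k ∈ Set.Icc (0 : ℝ) 1) {t : ℕ} (ht : t < T) :
    ∫ ω, ℓ t ω (i t ω) ∂μ =
      (∫ ω, stability (η t) (runLoss η ℓ σ j t ω) (σ t ω) (ℓ t ω) ∂μ) +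
      ∫ ω, weightedLoss η ℓ σ j t (j t ω) ω *
        winProb (η t • runLoss η ℓ σ j (t + 1) ω) (j t ω) ∂μ := by
  obtain ⟨D, hD⟩ := exists_weightedLoss_bound (σ := σ) (j := j) hη hℓ ht
  have hG := h.lossHistory_le ht
  have habs : ∀ k ω, |ℓ t ω k| ≤ 1 := fun k ω => by
    rw [abs_of_nonneg (hℓ t ht ω k).1]; exact (hℓ t ht ω k).2
  rw [h.integral_apply_exploit hη ht (f := fun k ω => ℓ t ω k)
    (measurable_loss_lossHistory ℱ ℓ t) habs]
  set f : Fin K → Ω → ℝ := fun k ω => weightedLoss η ℓ σ j t k ω *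
    winProb (η t • (runLoss η ℓ σ j t ω + Pi.single k (weightedLoss η ℓ σ j t k ω))) k with hf
  have hexp := h.integral_apply_explore ht (f := f) (C := D)
    (fun k => (h.measurable_weightedLoss ht k).mul (h.measurable_winProb_add ht k))
    (fun k ω => by
      rw [abs_of_nonneg (mul_nonneg (hD ω k).1 (winProb_nonneg _ _))]
      exact (mul_le_of_le_one_right (hD ω k).1 (winProb_le_one _ _)).trans (hD ω k).2)
  have hfj : ∀ ω, f (j t ω) ω = weightedLoss η ℓ σ j t (j t ω) ω *
        winProb (η t • runLoss η ℓ σ j (t + 1) ω) (j t ω) := fun ω => rfl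
  simp only [hfj] at hexp
  rw [hexp]
  -- The exploration probability cancels the importance weight, so only the effect of each arm's
  -- update on its own winning probability remains.
  have hpf : ∀ k ω, exploreProb 3 (η t) (runLoss η ℓ σ j t ω) (σ t ω) k * f k ω =
      ℓ t ω k * winProb (η t • (runLoss η ℓ σ j t ω +
        Pi.single k (weightedLoss η ℓ σ j t k ω))) k := fun k ω => by
    rw [← exploreProb_mul_weightedLoss (σ := σ) (j := j) (ℓ := ℓ) hη t k ω, hf]; ring
  simp only [hpf]
  have hi1 : ∀ k, Integrable (fun ω => ℓ t ω k * winProb (η t • runLoss η ℓ σ j t ω) k) μ :=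
    fun k => integrable_of_abs_le (C := 1) (((measurable_loss_lossHistory ℱ ℓ t k).mul
      ((h.measurable_winProb_runLoss ht k).mono le_sup_left le_rfl)).mono hG le_rfl) fun ω => by
        rw [abs_mul, abs_of_nonneg (winProb_nonneg _ _)]
        exact mul_le_one₀ (habs k ω) (winProb_nonneg _ _) (winProb_le_one _ _)
  have hi2 : ∀ k, Integrable (fun ω => ℓ t ω k * winProb (η t • (runLoss η ℓ σ j t ω +
        Pi.single k (weightedLoss η ℓ σ j t k ω))) k) μ :=
    fun k => integrable_of_abs_le (C := 1) (((measurable_loss_lossHistory ℱ ℓ t k).mul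
      (h.measurable_winProb_add ht k)).mono hG le_rfl) fun ω => by
        rw [abs_mul, abs_of_nonneg (winProb_nonneg _ _)]
        exact mul_le_one₀ (habs k ω) (winProb_nonneg _ _) (winProb_le_one _ _)
  have hstab : ∀ ω, stability (η t) (runLoss η ℓ σ j t ω) (σ t ω) (ℓ t ω) =
      ∑ k, (ℓ t ω k * winProb (η t • runLoss η ℓ σ j t ω) k -
        ℓ t ω k * winProb (η t • (runLoss η ℓ σ j t ω +
          Pi.single k (weightedLoss η ℓ σ j t k ω))) k) := fun ω => by
    simp only [stability, mul_sub, weightedLoss]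
  simp only [hstab]
  have hi3 : ∀ k ∈ Finset.univ, Integrable (fun ω =>
      ℓ t ω k * winProb (η t • runLoss η ℓ σ j t ω) k - ℓ t ω k *
        winProb (η t • (runLoss η ℓ σ j t ω + Pi.single k (weightedLoss η ℓ σ j t k ω))) k) μ :=
    fun k _ => (hi1 k).sub (hi2 k)
  rw [integral_finsetSum _ hi3, ← Finset.sum_add_distrib]
  refine Finset.sum_congr rfl fun k _ => ?_
  rw [integral_sub (hi1 k) (hi2 k), sub_add_cancel]

lemma integrable_runLoss [IsProbabilityMeasure μ] (h : IsRun μ 3 η T ℱ ℓ r σ i j)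
    (hη : ∀ t, 0 < η t) (hℓ : ∀ t < T, ∀ ω k, ℓ t ω k ∈ Set.Icc (0 : ℝ) 1) {t : ℕ} (ht : t ≤ T)
    (b : Fin K) : Integrable (fun ω => runLoss η ℓ σ j t ω b) μ := by
  obtain ⟨B, hB⟩ := exists_estLoss_bound hη K t
  refine integrable_of_abs_le (C := B)
    ((measurable_coord (h.measurable_runLoss ht) b).mono (ℱ.le _) le_rfl) fun ω => ?_
  have hL := hB (fun s => ℓ s ω) (fun s => σ s ω) (fun s => j s ω)
    (fun u hu k => hℓ u (hu.trans_le ht) ω k) b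
  rw [runLoss, abs_of_nonneg hL.1]
  exact hL.2

/-- The estimated losses are unbiased. -/
lemma integral_runLoss [IsProbabilityMeasure μ] (h : IsRun μ 3 η T ℱ ℓ r σ i j)
    (hη : ∀ t, 0 < η t) (hℓ : ∀ t < T, ∀ ω k, ℓ t ω k ∈ Set.Icc (0 : ℝ) 1) (b : Fin K)
    {n : ℕ} (hn : n ≤ T) :
    ∫ ω, runLoss η ℓ σ j n ω b ∂μ = ∑ t ∈ Finset.range n, ∫ ω, ℓ t ω b ∂μ := by
  induction n with
  | zero => simp [runLoss, estLoss]
  | succ t ih =>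
    have ht : t < T := hn
    rw [Finset.sum_range_succ, ← ih ht.le]
    obtain ⟨D, hD⟩ := exists_weightedLoss_bound (σ := σ) (j := j) hη hℓ ht
    -- The increment of coordinate b as a function of the explored arm.
    set f : Fin K → Ω → ℝ := fun k ω => if k = b then weightedLoss η ℓ σ j t b ω else 0 with hf
    have hD0 : ∀ ω : Ω, 0 ≤ D := fun ω => (hD ω b).1.trans (hD ω b).2
    have hfm : ∀ k, Measurable[lossHistory ℱ ℓ t] (f k) := fun k => by
      by_cases hk : k = b
      · simp only [hf, if_pos hk]; exact h.measurable_weightedLoss ht b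
      · simp only [hf, if_neg hk]; exact measurable_const
    have hexp := h.integral_apply_explore ht (f := f) (C := D) hfm
      (fun k ω => by
        simp only [hf]
        split_ifs with hk
        · rw [abs_of_nonneg (hD ω b).1]; exact (hD ω b).2
        · simpa using hD0 ω)
    have hstep : ∀ ω, f (j t ω) ω =
        runLoss η ℓ σ j (t + 1) ω b - runLoss η ℓ σ j t ω b := fun ω => by
      simp only [runLoss_succ, Pi.add_apply, add_sub_cancel_left, hf]
      by_cases hk : j t ω = b
      · rw [if_pos hk, hk, Pi.single_eq_same]
      · rw [if_neg hk, Pi.single_eq_of_ne (Ne.symm hk)]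
    rw [Finset.sum_eq_single b] at hexp
    · simp only [hstep] at hexp
      simp only [hf, if_true, exploreProb_mul_weightedLoss hη] at hexp
      rw [← hexp, integral_sub (h.integrable_runLoss hη hℓ hn b)
        (h.integrable_runLoss hη hℓ ht.le b)]
      ring
    · intro k _ hk
      simp [hf, hk]
    · simp

end IsRun

end

/-! ### The regret of a run: upper bound by the potential, lower bound by the gaps -/

section

variable {K : ℕ}

lemma measurable_apply_arm {Ω' : Type*} {_ : MeasurableSpace Ω'} {f : Fin K → Ω' → ℝ}
    (hf : ∀ k, Measurable (f k)) {a : Ω' → Fin K} (ha : Measurable a) :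
    Measurable fun ω => f (a ω) ω := by
  have h : Measurable fun p : Fin K × Ω' => f p.1 p.2 := measurable_from_prod_countable_right hf
  exact h.comp (ha.prodMk measurable_id)

variable {Ω : Type*} {η : ℕ → ℝ} {T : ℕ} {ℓ r : ℕ → Ω → Fin K → ℝ}
  {σ : ℕ → Ω → Equiv.Perm (Fin K)} {i j : ℕ → Ω → Fin K}

/-- Telescoping the potential along a run. -/
lemma sum_weightedLoss_mul_winProb_le (hη : ∀ t, 0 < η t)
    (hℓ : ∀ t < T, ∀ ω k, ℓ t ω k ∈ Set.Icc (0 : ℝ) 1) {β M : ℕ → ℝ} (hβ0 : β 0 = 0)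
    (hβs : ∀ t, β (t + 1) = (η t)⁻¹) (hβm : ∀ t, β t ≤ β (t + 1)) (hM : ∀ t, 1 ≤ M t)
    (b : Fin K) (ω : Ω) {n : ℕ} (hn : n ≤ T) :
    ∑ t ∈ Finset.range n, weightedLoss η ℓ σ j t (j t ω) ω *
        winProb (η t • runLoss η ℓ σ j (t + 1) ω) (j t ω) ≤
      potential b (β n) (runLoss η ℓ σ j n ω) + ∑ t ∈ Finset.range n, (β (t + 1) - β t) *
        (M t * (1 - winProb (η t • runLoss η ℓ σ j t ω) b) + 3 / 2 * (K / M t ^ 2)) := by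
  -- β n is the inverse learning rate of the preceding round. Each step first moves from β t to β (t
  -- + 1) at fixed losses, then adds the estimate at the new rate; β 0 = 0 makes the initial
  -- potential vanish.
  induction n with
  | zero =>
    have : runLoss η ℓ σ j 0 ω = 0 := rfl
    simp [hβ0, this, potential_zero]
  | succ t ih =>
    have ht : t < T := hn
    rw [Finset.sum_range_succ, Finset.sum_range_succ]
    have ih := ih ht.le
    obtain ⟨D, hD⟩ := exists_weightedLoss_bound (σ := σ) (j := j) hη hℓ ht
    have h1 := mul_winProb_le_potential_sub b (j t ω) (hη t) (hD ω (j t ω)).1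
      (runLoss η ℓ σ j t ω)
    rw [← runLoss_succ] at h1
    have h2 := potential_sub_le b (hη t) ((hβm t).trans_eq (hβs t)) (hM t) (runLoss η ℓ σ j t ω)
    rw [← hβs t] at h1 h2
    linarith

variable [m : MeasurableSpace Ω] {μ : Measure Ω} {ℱ : Filtration ℕ m}

namespace IsRun

lemma integrable_weightedLoss_mul_winProb [IsProbabilityMeasure μ]
    (h : IsRun μ 3 η T ℱ ℓ r σ i j) (hη : ∀ t, 0 < η t)
    (hℓ : ∀ t < T, ∀ ω k, ℓ t ω k ∈ Set.Icc (0 : ℝ) 1) {t : ℕ} (ht : t < T) :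
    Integrable (fun ω => weightedLoss η ℓ σ j t (j t ω) ω *
      winProb (η t • runLoss η ℓ σ j (t + 1) ω) (j t ω)) μ := by
  obtain ⟨D, hD⟩ := exists_weightedLoss_bound (σ := σ) (j := j) hη hℓ ht
  have hf : ∀ k, Measurable fun ω => weightedLoss η ℓ σ j t k ω *
      winProb (η t • (runLoss η ℓ σ j t ω + Pi.single k (weightedLoss η ℓ σ j t k ω))) k :=
    fun k => ((h.measurable_weightedLoss ht k).mul (h.measurable_winProb_add ht k)).mono
      (h.lossHistory_le ht) le_rfl
  have hm := measurable_apply_arm hf ((h.measurable_explore t ht).mono (ℱ.le _) le_rfl)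
  simp only [← runLoss_succ] at hm
  refine integrable_of_abs_le (C := D) hm fun ω => ?_
  have := hD ω (j t ω)
  rw [abs_of_nonneg (mul_nonneg this.1 (winProb_nonneg _ _))]
  exact (mul_le_of_le_one_right this.1 (winProb_le_one _ _)).trans this.2

/-- The basic regret bound of follow-the-perturbed-leader. -/
lemma sum_integral_sub_le [IsProbabilityMeasure μ] (h : IsRun μ 3 η T ℱ ℓ r σ i j)
    (hη : ∀ t, 0 < η t)
    (hℓ : ∀ t < T, ∀ ω k, ℓ t ω k ∈ Set.Icc (0 : ℝ) 1) {β M : ℕ → ℝ} (hβ0 : β 0 = 0)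
    (hβs : ∀ t, β (t + 1) = (η t)⁻¹) (hβm : ∀ t, β t ≤ β (t + 1)) (hM : ∀ t, 1 ≤ M t)
    (b : Fin K) :
    ∑ t ∈ Finset.range T, ((∫ ω, ℓ t ω (i t ω) ∂μ) - ∫ ω, ℓ t ω b ∂μ) ≤
      ∑ t ∈ Finset.range T, ((∫ ω, stability (η t) (runLoss η ℓ σ j t ω) (σ t ω) (ℓ t ω) ∂μ) +
        (β (t + 1) - β t) * (M t * (∫ ω, (1 - winProb (η t • runLoss η ℓ σ j t ω) b) ∂μ) +
          3 / 2 * (K / M t ^ 2))) := by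
  have hW : ∀ t ∈ Finset.range T, Integrable (fun ω =>
      1 - winProb (η t • runLoss η ℓ σ j t ω) b) μ := fun t ht =>
    (integrable_const _).sub (integrable_of_abs_le (C := 1)
      ((h.measurable_winProb_runLoss (Finset.mem_range.1 ht) b).mono (ℱ.le _) le_rfl) fun ω => by
        rw [abs_of_nonneg (winProb_nonneg _ _)]; exact winProb_le_one _ _)
  have hpen : ∀ t ∈ Finset.range T, Integrable (fun ω => (β (t + 1) - β t) *
      (M t * (1 - winProb (η t • runLoss η ℓ σ j t ω) b) + 3 / 2 * (K / M t ^ 2))) μ :=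
    fun t ht => (((hW t ht).const_mul _).add (integrable_const _)).const_mul _
  have hv : ∀ t ∈ Finset.range T, Integrable (fun ω => weightedLoss η ℓ σ j t (j t ω) ω *
        winProb (η t • runLoss η ℓ σ j (t + 1) ω) (j t ω)) μ := fun t ht =>
    h.integrable_weightedLoss_mul_winProb hη hℓ (Finset.mem_range.1 ht)
  have hR := h.integrable_runLoss hη hℓ le_rfl b
  have hmain : ∑ t ∈ Finset.range T, ∫ ω, weightedLoss η ℓ σ j t (j t ω) ω *
        winProb (η t • runLoss η ℓ σ j (t + 1) ω) (j t ω) ∂μ ≤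
      (∑ t ∈ Finset.range T, ∫ ω, ℓ t ω b ∂μ) + ∑ t ∈ Finset.range T, (β (t + 1) - β t) *
        (M t * (∫ ω, (1 - winProb (η t • runLoss η ℓ σ j t ω) b) ∂μ) +
          3 / 2 * (K / M t ^ 2)) := by
    have h1 : ∀ t ∈ Finset.range T, ∫ ω, (β (t + 1) - β t) *
        (M t * (1 - winProb (η t • runLoss η ℓ σ j t ω) b) + 3 / 2 * (K / M t ^ 2)) ∂μ =
        (β (t + 1) - β t) * (M t * (∫ ω, (1 - winProb (η t • runLoss η ℓ σ j t ω) b) ∂μ) +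
          3 / 2 * (K / M t ^ 2)) := fun t ht => by
      rw [integral_const_mul, integral_add ((hW t ht).const_mul _) (integrable_const _),
        integral_const_mul]
      simp
    rw [← Finset.sum_congr rfl h1, ← h.integral_runLoss hη hℓ b le_rfl, ← integral_finsetSum _ hv,
      ← integral_finsetSum _ hpen, ← integral_add hR (integrable_finsetSum _ hpen)]
    refine integral_mono (integrable_finsetSum _ hv) (hR.add (integrable_finsetSum _ hpen))
      fun ω => ?_
    refine (sum_weightedLoss_mul_winProb_le hη hℓ hβ0 hβs hβm hM b ω le_rfl).trans ?_
    exact add_le_add_left (potential_le _ _ _) _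
  have hsum : ∑ t ∈ Finset.range T, ∫ ω, ℓ t ω (i t ω) ∂μ =
      ∑ t ∈ Finset.range T, ((∫ ω, stability (η t) (runLoss η ℓ σ j t ω) (σ t ω) (ℓ t ω) ∂μ) +
      ∫ ω, weightedLoss η ℓ σ j t (j t ω) ω *
        winProb (η t • runLoss η ℓ σ j (t + 1) ω) (j t ω) ∂μ) :=
    Finset.sum_congr rfl fun t ht => h.integral_exploited_loss hη hℓ (Finset.mem_range.1 ht)
  rw [Finset.sum_sub_distrib, Finset.sum_add_distrib, hsum, Finset.sum_add_distrib]
  linarith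

/-- The winning probability depends on the history alone, so the conditional gap can be pulled out.
-/
lemma integral_sub_winProb [IsProbabilityMeasure μ] (h : IsRun μ 3 η T ℱ ℓ r σ i j)
    {Δ : Fin K → Fin K → ℝ} (hs : IsSCA μ T ℱ ℓ Δ) {t : ℕ} (ht : t < T) (k b : Fin K) :
    ∫ ω, (ℓ t ω k - ℓ t ω b) * winProb (η t • runLoss η ℓ σ j t ω) k ∂μ =
      Δ k b * ∫ ω, winProb (η t • runLoss η ℓ σ j t ω) k ∂μ := by
  have hG := h.lossHistory_le ht
  have hY : Integrable (fun ω => ℓ t ω k - ℓ t ω b) μ :=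
    integrable_of_abs_le (C := 1) (((measurable_loss_lossHistory ℱ ℓ t k).sub
      (measurable_loss_lossHistory ℱ ℓ t b)).mono hG le_rfl) fun ω => by
        have h1 := hs.loss_mem t ht ω k
        have h2 := hs.loss_mem t ht ω b
        exact abs_le.2 ⟨by linarith [h1.1, h2.2], by linarith [h1.2, h2.1]⟩
  rw [integral_mul_of_condExp (ℱ.le t) hY (hs.gap t ht k b) (h.measurable_winProb_runLoss ht k)
    (C := 1) fun ω => by rw [abs_of_nonneg (winProb_nonneg _ _)]; exact winProb_le_one _ _]
  rw [integral_const_mul]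

/-- The regret of a round is at least the smallest gap times the probability of a suboptimal
exploited arm. -/
lemma mul_integral_le_regret [IsProbabilityMeasure μ] (h : IsRun μ 3 η T ℱ ℓ r σ i j)
    (hη : ∀ t, 0 < η t) {Δ : Fin K → Fin K → ℝ} (hs : IsSCA μ T ℱ ℓ Δ) {b : Fin K} {D : ℝ}
    (hD : ∀ k, k ≠ b → D ≤ Δ k b) {t : ℕ} (ht : t < T) :
    D * (∫ ω, (1 - winProb (η t • runLoss η ℓ σ j t ω) b) ∂μ) ≤
      (∫ ω, ℓ t ω (i t ω) ∂μ) - ∫ ω, ℓ t ω b ∂μ := by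
  have hG := h.lossHistory_le ht
  have hW : ∀ k, Integrable (fun ω => winProb (η t • runLoss η ℓ σ j t ω) k) μ := fun k =>
    integrable_of_abs_le (C := 1)
      ((h.measurable_winProb_runLoss ht k).mono (ℱ.le _) le_rfl) fun ω => by
        rw [abs_of_nonneg (winProb_nonneg _ _)]; exact winProb_le_one _ _
  have hℓm : ∀ k, Measurable fun ω => ℓ t ω k := fun k =>
    (measurable_loss_lossHistory ℱ ℓ t k).mono hG le_rfl
  have habs : ∀ k ω, |ℓ t ω k| ≤ 1 := fun k ω => by
    have := hs.loss_mem t ht ω k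
    rw [abs_of_nonneg this.1]; exact this.2
  -- The constant function 1 shows that the winning probabilities sum to 1 in mean.
  have hone := h.integral_apply_exploit hη ht (f := fun _ _ => 1) (fun _ => measurable_const)
    (C := 1) (by simp)
  simp only [integral_const, probReal_univ, smul_eq_mul, one_mul] at hone
  have hreg := h.integral_apply_exploit hη ht (f := fun k ω => ℓ t ω k - ℓ t ω b)
    (fun k => (measurable_loss_lossHistory ℱ ℓ t k).sub (measurable_loss_lossHistory ℱ ℓ t b))
    (C := 1) (fun k ω => by
        have h1 := hs.loss_mem t ht ω k
        have h2 := hs.loss_mem t ht ω b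
        exact abs_le.2 ⟨by linarith [h1.1, h2.2], by linarith [h1.2, h2.1]⟩)
  simp only [h.integral_sub_winProb hs ht] at hreg
  rw [integral_sub (integrable_of_abs_le (C := 1) (measurable_apply_arm hℓm
    ((h.measurable_exploit t ht).mono (ℱ.le _) le_rfl)) fun ω => habs _ ω)
    (integrable_of_abs_le (hℓm b) (habs b))] at hreg
  have hbb : Δ b b * ∫ ω, winProb (η t • runLoss η ℓ σ j t ω) b ∂μ = 0 := by
    rw [← h.integral_sub_winProb hs ht b b]; simp
  rw [hreg, integral_sub (integrable_const _) (hW b), ← Finset.add_sum_erase _ _ (Finset.mem_univ b),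
    hbb, zero_add]
  rw [← Finset.add_sum_erase _ _ (Finset.mem_univ b)] at hone
  simp only [integral_const, probReal_univ, smul_eq_mul, one_mul]
  rw [hone, add_sub_cancel_left, Finset.mul_sum]
  exact Finset.sum_le_sum fun k hk => mul_le_mul_of_nonneg_right (hD k (Finset.ne_of_mem_erase hk))
    (integral_nonneg fun ω => winProb_nonneg _ _)

end IsRun

/-- The fixed gaps are the expected loss differences. -/
lemma IsSCA.integral_sub_eq [IsProbabilityMeasure μ] {Δ : Fin K → Fin K → ℝ}
    (hs : IsSCA μ T ℱ ℓ Δ) {t : ℕ} (ht : t < T) (k k' : Fin K) :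
    ∫ ω, (ℓ t ω k - ℓ t ω k') ∂μ = Δ k k' := by
  rw [← integral_condExp (ℱ.le t), integral_congr_ae (hs.gap t ht k k')]
  simp

end

/-! ### The self-bounding argument for real sequences -/

section

lemma sqrt_succ_sub_sqrt_le (t : ℕ) : √((t : ℝ) + 1) - √(t : ℝ) ≤ 1 / √((t : ℝ) + 1) := by
  have h1 : √((t : ℝ) + 1) ^ 2 = t + 1 := Real.sq_sqrt (by positivity)
  have h2 : √(t : ℝ) ^ 2 = t := Real.sq_sqrt (by positivity)
  have h3 : √(t : ℝ) ≤ √((t : ℝ) + 1) := Real.sqrt_le_sqrt (by linarith)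
  have h0 : 0 < √((t : ℝ) + 1) := Real.sqrt_pos.2 (by positivity)
  rw [le_div_iff₀ h0]
  nlinarith [Real.sqrt_nonneg (t : ℝ)]

/-- A sum that decays like `t ^ (-1/2)` at first and like `t ^ (-3/2)` later. -/
lemma sum_two_phase_le {A E N : ℝ} (hA : 0 ≤ A) (hE : 0 ≤ E) (hN : 0 < N) (n : ℕ) :
    ∑ t ∈ Finset.range n, (if √((t : ℝ) + 1) < N then A / √((t : ℝ) + 1)
      else E / √((t : ℝ) + 1) ^ 3) ≤
    2 * A * min N √(n : ℝ) + 4 * E * (1 / N - min (1 / N) (1 / √((n : ℝ) + 1))) := by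
  -- The two minima make the bound inductive: √n telescopes while below N, and −1/√(n+1) starts from
  -- 1/N afterwards.
  induction n with
  | zero =>
    have : min (1 / N) 1 ≤ 1 / N := min_le_left _ _
    simp only [Finset.range_zero, Finset.sum_empty, Nat.cast_zero, Real.sqrt_zero, zero_add,
      Real.sqrt_one, div_one]
    rw [min_eq_right hN.le]
    nlinarith
  | succ n ih =>
    rw [Finset.sum_range_succ]
    push_cast
    set s₀ := √(n : ℝ)
    set s := √((n : ℝ) + 1)
    set s₁ := √((n : ℝ) + 1 + 1)
    have e0 : s₀ ^ 2 = n := Real.sq_sqrt (by positivity)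
    have e1 : s ^ 2 = n + 1 := Real.sq_sqrt (by positivity)
    have e2 : s₁ ^ 2 = n + 1 + 1 := Real.sq_sqrt (by positivity)
    have h00 : 0 ≤ s₀ := Real.sqrt_nonneg _
    have hs : 0 < s := Real.sqrt_pos.2 (by positivity)
    have hs1 : 0 < s₁ := Real.sqrt_pos.2 (by positivity)
    have h01 : s₀ ≤ s := Real.sqrt_le_sqrt (by linarith)
    have h12 : s ≤ s₁ := Real.sqrt_le_sqrt (by linarith)
    have hn : (0 : ℝ) ≤ n := by positivity
    have hmin1 : min N s₀ ≤ min N s := min_le_min_left _ h01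
    have hmin2 : min (1 / N) (1 / s₁) ≤ min (1 / N) (1 / s) :=
      min_le_min_left _ (one_div_le_one_div_of_le hs h12)
    split_ifs with h
    · have h1 : 1 / s ≤ 2 * (s - s₀) := by
        rw [div_le_iff₀ hs]; nlinarith
      have h2 : A / s ≤ 2 * A * (s - s₀) := by
        calc A / s = A * (1 / s) := by ring
          _ ≤ A * (2 * (s - s₀)) := by gcongr
          _ = _ := by ring
      rw [min_eq_right h.le, min_eq_right (h01.trans h.le)] at *
      have := mul_le_mul_of_nonneg_left hmin2 hE
      nlinarith
    · have h := not_lt.1 h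
      have h1 : 1 / s ^ 3 ≤ 4 * (1 / s - 1 / s₁) := by
        have h21 : s₁ ≤ 2 * s := by nlinarith
        have h4 : s₁ * (s + s₁) ≤ 4 * s ^ 2 := by nlinarith
        rw [div_sub_div _ _ hs.ne' hs1.ne', mul_div_assoc', div_le_div_iff₀ (by positivity)
          (by positivity)]
        have h5 : (s₁ - s) * (s + s₁) = 1 := by linear_combination e2 - e1
        have h6 : 0 ≤ s₁ - s := by linarith
        have h7 := mul_le_mul_of_nonneg_left h4 (mul_nonneg hs.le h6)
        have h8 : s * (s₁ - s) * (s₁ * (s + s₁)) = s * s₁ := by linear_combination s * s₁ * h5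
        nlinarith
      have h2 : E / s ^ 3 ≤ 4 * E * (1 / s - 1 / s₁) := by
        calc E / s ^ 3 = E * (1 / s ^ 3) := by ring
          _ ≤ E * (4 * (1 / s - 1 / s₁)) := by gcongr
          _ = _ := by ring
      have h3 : 1 / s ≤ 1 / N := one_div_le_one_div_of_le hN h
      have h4 : 1 / s₁ ≤ 1 / N := one_div_le_one_div_of_le hN (h.trans h12)
      rw [min_eq_right h3] at ih
      rw [min_eq_right h4]
      have := mul_le_mul_of_nonneg_left hmin1 hA
      nlinarith

lemma sum_two_phase_le' {A E N : ℝ} (hA : 0 ≤ A) (hE : 0 ≤ E) (hN : 0 < N) (n : ℕ) :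
    ∑ t ∈ Finset.range n, (if √((t : ℝ) + 1) < N then A / √((t : ℝ) + 1)
      else E / √((t : ℝ) + 1) ^ 3) ≤ 2 * A * N + 4 * E / N := by
  refine (sum_two_phase_le hA hE hN n).trans (add_le_add ?_ ?_)
  · gcongr; exact min_le_left _ _
  · rw [← mul_one_div (4 * E)]
    gcongr
    exact sub_le_self _ (le_min (by positivity) (by positivity))

/-- The contribution of a round to the regret bound, for a suitable tuning parameter. -/
lemma exists_round_bound {c C₁ κ D S X u Δβ : ℝ} (hc : 0 < c) (hC₁ : 1 ≤ C₁) (hκ : 1 ≤ κ)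
    (hD : 0 < D) (hD1 : D ≤ 1) (hu : 1 ≤ u) (hX0 : 0 ≤ X) (hX1 : X ≤ 1)
    (hS1 : S ≤ C₁ * (c / (κ * u)) * κ ^ 4)
    (hS2 : ∀ a, 1 ≤ a → 6 * (c / (κ * u)) * κ ^ 2 ≤ 1 →
      S ≤ C₁ * (c / (κ * u)) * κ ^ 2 * (a * X + κ ^ 6 / a ^ 2))
    (hβ : Δβ ≤ κ / c * (1 / u)) :
    ∃ M, 1 ≤ M ∧ S + Δβ * (M * X + 3 / 2 * (κ ^ 6 / M ^ 2)) ≤ 1 / 2 * (D * X) +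
      (if u < (2 * (C₁ * c + 5 / 2 / c) + 6 * c) * κ ^ 3 / D then (C₁ * c + 5 / 2 / c) * κ ^ 3 / u
        else 4 * (C₁ * c + 5 / 2 / c) ^ 3 * κ ^ 9 / D ^ 2 / u ^ 3) := by
  set C₂ := C₁ * c + 5 / 2 / c with hC₂
  have hκ0 : 0 < κ := by linarith
  have hu0 : 0 < u := by linarith
  have hC₂0 : 0 < C₂ := by positivity
  have hc0 : 0 < 1 / c := by positivity
  split_ifs with h
  -- Early rounds: M = κ² balances M against κ⁶/M².
  · refine ⟨κ ^ 2, one_le_pow₀ hκ, ?_⟩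
    have h1 : κ ^ 2 * X + 3 / 2 * (κ ^ 6 / (κ ^ 2) ^ 2) ≤ 5 / 2 * κ ^ 2 := by
      have : κ ^ 6 / (κ ^ 2) ^ 2 = κ ^ 2 := by field_simp
      rw [this]
      nlinarith [sq_nonneg κ]
    have h2 : 0 ≤ κ ^ 2 * X + 3 / 2 * (κ ^ 6 / (κ ^ 2) ^ 2) := by positivity
    have h3 := mul_le_mul hβ h1 h2 (by positivity)
    have h4 : C₁ * (c / (κ * u)) * κ ^ 4 + κ / c * (1 / u) * (5 / 2 * κ ^ 2) =
        C₂ * κ ^ 3 / u := by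
      rw [hC₂]; field_simp
    have h5 : 0 ≤ 1 / 2 * (D * X) := by positivity
    linarith
  · have h := not_lt.1 h
    have hκ3 : κ ≤ κ ^ 3 := le_self_pow₀ hκ (by norm_num)
    rw [div_le_iff₀ hD] at h
    -- The summand 2C₂ of the threshold yields a ≥ 1 and the summand 6c the smallness of the
    -- learning rate. The factor κ³ in place of κ balances the two phases.
    have huD : (2 * C₂ + 6 * c) * κ ≤ u * D := (mul_le_mul_of_nonneg_left hκ3 (by positivity)).trans h
    -- Chosen so that C₂κ/u · aX is exactly DX/2; the same value tunes stability and penalty.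
    set a := D * u / (2 * C₂ * κ) with ha
    have ha1 : 1 ≤ a := by
      rw [ha, le_div_iff₀ (by positivity)]
      have : 0 ≤ 6 * c * κ := by positivity
      linarith
    have ha0 : 0 < a := by linarith
    have hη : 6 * (c / (κ * u)) * κ ^ 2 ≤ 1 := by
      have : 6 * (c / (κ * u)) * κ ^ 2 = 6 * c * κ / u := by field_simp
      rw [this, div_le_one hu0]
      have h1 : 0 ≤ 2 * C₂ * κ := by positivity
      have h2 : u * D ≤ u * 1 := by gcongr
      linarith
    refine ⟨a, ha1, ?_⟩
    have h1 := hS2 a ha1 hη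
    set Q := a * X + κ ^ 6 / a ^ 2 with hQ
    have hP : 0 ≤ κ ^ 6 / a ^ 2 := by positivity
    have haX : 0 ≤ a * X := by positivity
    have hQ0 : 0 ≤ Q := by positivity
    have h2 : a * X + 3 / 2 * (κ ^ 6 / a ^ 2) ≤ 5 / 2 * Q := by rw [hQ]; linarith
    have h3 := mul_le_mul hβ h2 (by positivity) (by positivity)
    have h4 : C₁ * (c / (κ * u)) * κ ^ 2 * Q + κ / c * (1 / u) * (5 / 2 * Q) =
        C₂ * κ / u * Q := by
      rw [hC₂]; field_simp
    have h5 : C₂ * κ / u * Q = 1 / 2 * (D * X) + 4 * C₂ ^ 3 * κ ^ 9 / D ^ 2 / u ^ 3 := by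
      rw [hQ, ha]; field_simp; ring
    linarith

/-- The self-bounding argument. -/
lemma regret_le_of_self_bounding {c C₁ κ D R : ℝ} {n : ℕ} {X S : ℕ → ℝ} (hc : 0 < c)
    (hC₁ : 1 ≤ C₁) (hκ : 1 ≤ κ) (hD : 0 < D) (hD1 : D ≤ 1) (hX0 : ∀ t < n, 0 ≤ X t)
    (hX1 : ∀ t < n, X t ≤ 1)
    (hS1 : ∀ t < n, S t ≤ C₁ * (c / (κ * √((t : ℝ) + 1))) * κ ^ 4)
    (hS2 : ∀ t < n, ∀ a, 1 ≤ a → 6 * (c / (κ * √((t : ℝ) + 1))) * κ ^ 2 ≤ 1 →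
      S t ≤ C₁ * (c / (κ * √((t : ℝ) + 1))) * κ ^ 2 * (a * X t + κ ^ 6 / a ^ 2))
    (hlow : D * ∑ t ∈ Finset.range n, X t ≤ R)
    (hup : ∀ M : ℕ → ℝ, (∀ t, 1 ≤ M t) → R ≤ ∑ t ∈ Finset.range n, (S t +
      (κ / c * √((t : ℝ) + 1) - κ / c * √(t : ℝ)) *
        (M t * X t + 3 / 2 * (κ ^ 6 / M t ^ 2)))) :
    R ≤ (4 * (C₁ * c + 5 / 2 / c) * (2 * (C₁ * c + 5 / 2 / c) + 6 * c) +
      32 * (C₁ * c + 5 / 2 / c) ^ 3 / (2 * (C₁ * c + 5 / 2 / c) + 6 * c)) * (κ ^ 6 / D) := by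
  have hround : ∀ t, ∃ M, 1 ≤ M ∧ (t < n → S t + (κ / c * √((t : ℝ) + 1) - κ / c * √(t : ℝ)) *
        (M * X t + 3 / 2 * (κ ^ 6 / M ^ 2)) ≤ 1 / 2 * (D * X t) +
      (if √((t : ℝ) + 1) < (2 * (C₁ * c + 5 / 2 / c) + 6 * c) * κ ^ 3 / D
        then (C₁ * c + 5 / 2 / c) * κ ^ 3 / √((t : ℝ) + 1)
        else 4 * (C₁ * c + 5 / 2 / c) ^ 3 * κ ^ 9 / D ^ 2 / √((t : ℝ) + 1) ^ 3)) := by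
    intro t
    by_cases ht : t < n
    · have hκc : 0 ≤ κ / c := by positivity
      obtain ⟨M, hM, h⟩ := exists_round_bound hc hC₁ hκ hD hD1
        (Real.one_le_sqrt.2 (by linarith [Nat.cast_nonneg (α := ℝ) t])) (hX0 t ht) (hX1 t ht)
        (hS1 t ht) (hS2 t ht) (Δβ := κ / c * √((t : ℝ) + 1) - κ / c * √(t : ℝ))
        (by rw [← mul_sub]; exact mul_le_mul_of_nonneg_left (sqrt_succ_sub_sqrt_le t) hκc)
      exact ⟨M, hM, fun _ => h⟩
    · exact ⟨1, le_rfl, fun h => absurd h ht⟩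
  -- The cut-offs may depend on the gap, since they enter only the analysis.
  choose M hM hb using hround
  set C₂ := C₁ * c + 5 / 2 / c with hC₂
  set B := 2 * C₂ + 6 * c with hB
  have hκ0 : 0 < κ := by linarith
  have hC₂0 : 0 < C₂ := by positivity
  have hB0 : 0 < B := by positivity
  have h1 := (hup M hM).trans (Finset.sum_le_sum fun t ht => hb t (Finset.mem_range.1 ht))
  rw [Finset.sum_add_distrib, ← Finset.mul_sum, ← Finset.mul_sum] at h1
  have h2 := sum_two_phase_le' (A := C₂ * κ ^ 3) (E := 4 * C₂ ^ 3 * κ ^ 9 / D ^ 2)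
    (N := B * κ ^ 3 / D) (by positivity) (by positivity) (by positivity) n
  -- Half of the target: the other half pays for absorbing D ∑ X / 2 ≤ R / 2.
  have h3 : 2 * (C₂ * κ ^ 3) * (B * κ ^ 3 / D) + 4 * (4 * C₂ ^ 3 * κ ^ 9 / D ^ 2) /
      (B * κ ^ 3 / D) = 1 / 2 * ((4 * C₂ * B + 32 * C₂ ^ 3 / B) * (κ ^ 6 / D)) := by
    field_simp; ring
  linarith

end

/-! ### Assembly for the prescribed learning rate -/

section

lemma learningRate_eq (c : ℝ) (K t : ℕ) :
    learningRate 3 c K t = c / ((K : ℝ) ^ (1 / 6 : ℝ) * √((t : ℝ) + 1)) := by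
  rw [learningRate, show (1 / 3 - 1 / 2 : ℝ) = -(1 / 6) by norm_num,
    Real.rpow_neg (Nat.cast_nonneg K)]
  rw [← div_eq_mul_inv, div_div]

variable {K : ℕ} {Ω : Type*} [m : MeasurableSpace Ω] {μ : Measure Ω} [IsProbabilityMeasure μ]
  {T : ℕ} {ℱ : Filtration ℕ m} {ℓ r : ℕ → Ω → Fin K → ℝ}
  {σ : ℕ → Ω → Equiv.Perm (Fin K)} {i j : ℕ → Ω → Fin K}

/-- The regret bound in terms of the number of arms and the smallest gap. -/
lemma IsRun.regret_le {c D : ℝ} (hc : 0 < c) (hK : 2 ≤ K)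
    (h : IsRun μ 3 (learningRate 3 c K) T ℱ ℓ r σ i j) {Δ : Fin K → Fin K → ℝ}
    (hs : IsSCA μ T ℱ ℓ Δ) {b : Fin K} (hD0 : 0 < D) (hD1 : D ≤ 1)
    (hD : ∀ k, k ≠ b → D ≤ Δ k b) :
    ∑ t ∈ Finset.range T, ((∫ ω, ℓ t ω (i t ω) ∂μ) - ∫ ω, ℓ t ω b ∂μ) ≤
      (4 * (900 * rankConst * c + 5 / 2 / c) * (2 * (900 * rankConst * c + 5 / 2 / c) + 6 * c) +
      32 * (900 * rankConst * c + 5 / 2 / c) ^ 3 /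
        (2 * (900 * rankConst * c + 5 / 2 / c) + 6 * c)) * (K / D) := by
  set η := learningRate 3 c K with hη_def
  set κ : ℝ := (K : ℝ) ^ (1 / 6 : ℝ) with hκ_def
  have hK1 : (1 : ℝ) ≤ K := by exact_mod_cast (by omega : 1 ≤ K)
  have hκ1 : 1 ≤ κ := Real.one_le_rpow hK1 (by norm_num)
  have hκ0 : 0 < κ := by linarith
  have hκ6 : κ ^ 6 = K := by
    rw [hκ_def, ← Real.rpow_natCast, ← Real.rpow_mul (by positivity)]; norm_num
  have hκ2 : (K : ℝ) ^ (1 / 3 : ℝ) = κ ^ 2 := by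
    rw [hκ_def, ← Real.rpow_natCast, ← Real.rpow_mul (by positivity)]; norm_num
  have hη_eq : ∀ t : ℕ, η t = c / (κ * √((t : ℝ) + 1)) := fun t => learningRate_eq c K t
  have hη : ∀ t, 0 < η t := fun t => by
    have : 0 < √((t : ℝ) + 1) := Real.sqrt_pos.2 (by positivity)
    rw [hη_eq]; positivity
  have hR := one_le_rankConst
  set X : ℕ → ℝ := fun t => ∫ ω, (1 - winProb (η t • runLoss η ℓ σ j t ω) b) ∂μ with hX
  set S : ℕ → ℝ := fun t => ∫ ω, stability (η t) (runLoss η ℓ σ j t ω) (σ t ω) (ℓ t ω) ∂μ with hS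
  have hW : ∀ t < T, Integrable (fun ω => 1 - winProb (η t • runLoss η ℓ σ j t ω) b) μ :=
    fun t ht => (integrable_const _).sub (integrable_of_abs_le (C := 1)
      ((h.measurable_winProb_runLoss ht b).mono (ℱ.le _) le_rfl) fun ω => by
        rw [abs_of_nonneg (winProb_nonneg _ _)]; exact winProb_le_one _ _)
  have hX0 : ∀ t < T, 0 ≤ X t := fun t _ =>
    integral_nonneg fun ω => sub_nonneg.2 (winProb_le_one _ _)
  have hX1 : ∀ t < T, X t ≤ 1 := fun t ht => by
    calc X t ≤ ∫ _, (1 : ℝ) ∂μ := integral_mono (hW t ht) (integrable_const _) fun ω =>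
          sub_le_self _ (winProb_nonneg _ _)
      _ = 1 := by simp
  have hstab0 : ∀ t < T, ∀ ω, 0 ≤ stability (η t) (runLoss η ℓ σ j t ω) (σ t ω) (ℓ t ω) := by
    intro t ht ω
    refine Finset.sum_nonneg fun k _ => ?_
    have hp := exploreProb_pos (hη t) (runLoss η ℓ σ j t ω) (σ t ω) k
    have hℓ0 := (hs.loss_mem t ht ω k).1
    refine mul_nonneg hℓ0 (sub_nonneg.2 ?_)
    rw [winProb_smul_add_single, winProb_smul]
    exact winProb_add_single_le _ _ (mul_nonneg (hη t).le (div_nonneg hℓ0 hp.le))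
  have hS1 : ∀ t < T, S t ≤ 900 * rankConst * (c / (κ * √((t : ℝ) + 1))) * κ ^ 4 := by
    intro t ht
    have hb : ∀ ω, stability (η t) (runLoss η ℓ σ j t ω) (σ t ω) (ℓ t ω) ≤
        900 * rankConst * (c / (κ * √((t : ℝ) + 1))) * κ ^ 4 := fun ω => by
      refine (stability_le hK (hη t) (h.rank t ht ω) (hs.loss_mem t ht ω)).trans ?_
      rw [hκ2, ← hη_eq]
      have := (hη t).le
      calc 27 * rankConst * η t * (κ ^ 2) ^ 2 = 27 * (rankConst * η t * κ ^ 4) := by ring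
        _ ≤ 900 * (rankConst * η t * κ ^ 4) := by gcongr; norm_num
        _ = _ := by ring
    calc S t ≤ ∫ _, 900 * rankConst * (c / (κ * √((t : ℝ) + 1))) * κ ^ 4 ∂μ :=
          integral_mono_of_nonneg (ae_of_all _ (hstab0 t ht)) (integrable_const _)
            (ae_of_all _ hb)
      _ = _ := by simp
  have hS2 : ∀ t < T, ∀ a, 1 ≤ a → 6 * (c / (κ * √((t : ℝ) + 1))) * κ ^ 2 ≤ 1 →
      S t ≤ 900 * rankConst * (c / (κ * √((t : ℝ) + 1))) * κ ^ 2 *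
        (a * X t + κ ^ 6 / a ^ 2) := by
    intro t ht a ha hηκ
    rw [← hη_eq] at hηκ ⊢
    rw [hκ6]
    have hint : Integrable (fun ω => 900 * rankConst * η t * κ ^ 2 *
        (a * (1 - winProb (η t • runLoss η ℓ σ j t ω) b) + K / a ^ 2)) μ :=
      (((hW t ht).const_mul a).add (integrable_const _)).const_mul _
    calc S t ≤ ∫ ω, 900 * rankConst * η t * κ ^ 2 *
          (a * (1 - winProb (η t • runLoss η ℓ σ j t ω) b) + K / a ^ 2) ∂μ := by
          refine integral_mono_of_nonneg (ae_of_all _ (hstab0 t ht)) hint (ae_of_all _ fun ω => ?_)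
          have := stability_le_self_bounding hK (hη t) ha (by rwa [hκ2]) (h.rank t ht ω)
            (hs.loss_mem t ht ω) b
          rwa [hκ2] at this
      _ = _ := by
          rw [integral_const_mul, integral_add ((hW t ht).const_mul a) (integrable_const _),
            integral_const_mul]
          simp [hX]
  have hlow : D * ∑ t ∈ Finset.range T, X t ≤
      ∑ t ∈ Finset.range T, ((∫ ω, ℓ t ω (i t ω) ∂μ) - ∫ ω, ℓ t ω b ∂μ) := by
    rw [Finset.mul_sum]
    exact Finset.sum_le_sum fun t ht =>
      h.mul_integral_le_regret hη hs hD (Finset.mem_range.1 ht)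
  have hup : ∀ M : ℕ → ℝ, (∀ t, 1 ≤ M t) →
      ∑ t ∈ Finset.range T, ((∫ ω, ℓ t ω (i t ω) ∂μ) - ∫ ω, ℓ t ω b ∂μ) ≤
      ∑ t ∈ Finset.range T, (S t + (κ / c * √((t : ℝ) + 1) - κ / c * √(t : ℝ)) *
        (M t * X t + 3 / 2 * (κ ^ 6 / M t ^ 2))) := by
    intro M hM
    -- Since rounds start at index 0, κ√t/c is the inverse rate of round t − 1 and vanishes at t =
    -- 0.
    have := h.sum_integral_sub_le hη hs.loss_mem (β := fun t => κ / c * √(t : ℝ)) (M := M)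
      (by simp) (fun t => by push_cast; rw [hη_eq, inv_div]; ring)
      (fun t => by push_cast; gcongr; linarith) hM b
    push_cast at this
    rwa [hκ6]
  have := regret_le_of_self_bounding hc (by linarith) hκ1 hD0 hD1 hX0 hX1 hS1 hS2 hlow hup
  rwa [hκ6] at this

/-- The pseudo-regret is at most the regret with respect to an arm of smallest expected loss. -/
lemma IsRun.pseudoRegret_le {α : ℝ} {η : ℕ → ℝ} (h : IsRun μ α η T ℱ ℓ r σ i j)
    {Δ : Fin K → Fin K → ℝ} (hs : IsSCA μ T ℱ ℓ Δ) {b : Fin K} (hΔ : ∀ k, k ≠ b → 0 < Δ k b) :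
    pseudoRegret μ T ℓ i ≤
      ∑ t ∈ Finset.range T, ((∫ ω, ℓ t ω (i t ω) ∂μ) - ∫ ω, ℓ t ω b ∂μ) := by
  have : Nonempty (Fin K) := ⟨b⟩
  have hm : ∀ t ∈ Finset.range T, ∀ k, Measurable fun ω => ℓ t ω k := fun t ht k =>
    measurable_coord ((h.measurable_loss t (Finset.mem_range.1 ht)).mono (ℱ.le _) le_rfl) k
  have habs : ∀ t ∈ Finset.range T, ∀ k ω, |ℓ t ω k| ≤ 1 := fun t ht k ω => by
    have := hs.loss_mem t (Finset.mem_range.1 ht) ω k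
    rw [abs_of_nonneg this.1]; exact this.2
  have hint : ∀ k, ∀ t ∈ Finset.range T, Integrable (fun ω => ℓ t ω k) μ := fun k t ht =>
    integrable_of_abs_le (hm t ht k) (habs t ht k)
  have hinti : ∀ t ∈ Finset.range T, Integrable (fun ω => ℓ t ω (i t ω)) μ := fun t ht =>
    integrable_of_abs_le (measurable_apply_arm (f := fun k ω => ℓ t ω k) (hm t ht)
      ((h.measurable_exploit t (Finset.mem_range.1 ht)).mono (ℱ.le _) le_rfl))
      fun ω => habs t ht _ ω
  rw [pseudoRegret, integral_finsetSum _ hinti, Finset.sum_sub_distrib]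
  refine sub_le_sub_left (le_ciInf fun k => ?_) _
  rw [integral_finsetSum _ (hint k)]
  refine Finset.sum_le_sum fun t ht => ?_
  by_cases hk : k = b
  · rw [hk]
  · rw [← sub_nonneg, ← integral_sub (hint k t ht) (hint b t ht),
      hs.integral_sub_eq (Finset.mem_range.1 ht)]
    exact (hΔ k hk).le

end

end DecoupledBandit

end

theorem corollary1 (c : ℝ) (hc : 0 < c) :
    ∃ C : ℝ, 0 < C ∧ ∀ (K : ℕ), 2 ≤ K → ∀ (T : ℕ)
      (Ω : Type*) [m : MeasurableSpace Ω] (μ : Measure Ω) [IsProbabilityMeasure μ]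
      (ℱ : Filtration ℕ m) (ℓ r : ℕ → Ω → Fin K → ℝ) (σ : ℕ → Ω → Equiv.Perm (Fin K))
      (i j : ℕ → Ω → Fin K) (Δ : Fin K → Fin K → ℝ) (best : Fin K),
      DecoupledBandit.IsSCA μ T ℱ ℓ Δ →
      (∀ k, k ≠ best → 0 < Δ k best) →
      DecoupledBandit.IsRun μ 3 (DecoupledBandit.learningRate 3 c K) T ℱ ℓ r σ i j →
      DecoupledBandit.pseudoRegret μ T ℓ i ≤
        C * (√((K : ℝ) / DecoupledBandit.minGap Δ best *
              ∑ k ∈ Finset.univ.erase best, 1 / Δ k best)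
            + (K : ℝ) / DecoupledBandit.minGap Δ best) := by
  have hR := DecoupledBandit.one_le_rankConst
  have hC₂ : 0 < 900 * DecoupledBandit.rankConst * c + 5 / 2 / c := by positivity
  refine ⟨4 * (900 * DecoupledBandit.rankConst * c + 5 / 2 / c) *
      (2 * (900 * DecoupledBandit.rankConst * c + 5 / 2 / c) + 6 * c) +
      32 * (900 * DecoupledBandit.rankConst * c + 5 / 2 / c) ^ 3 /
        (2 * (900 * DecoupledBandit.rankConst * c + 5 / 2 / c) + 6 * c), by positivity, ?_⟩
  intro K hK T Ω m μ _ ℱ ℓ r σ i j Δ best hs hΔ h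
  have : Nontrivial (Fin K) := Fin.nontrivial_iff_two_le.2 hK
  obtain ⟨k₁, hk₁⟩ := exists_ne best
  have : Nonempty {k : Fin K // k ≠ best} := ⟨⟨k₁, hk₁⟩⟩
  have hD0 : 0 < DecoupledBandit.minGap Δ best := by
    obtain ⟨k, hk⟩ := exists_eq_ciInf_of_finite (f := fun k : {k : Fin K // k ≠ best} => Δ k best)
    rw [DecoupledBandit.minGap, ← hk]
    exact hΔ k k.2
  have hD : ∀ k, k ≠ best → DecoupledBandit.minGap Δ best ≤ Δ k best := fun k hk =>
    ciInf_le (f := fun k : {k : Fin K // k ≠ best} => Δ k best)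
      (Set.finite_range _).bddBelow ⟨k, hk⟩
  refine (h.pseudoRegret_le hs hΔ).trans ?_
  rw [mul_add]
  refine le_add_of_nonneg_of_le (by positivity) ?_
  -- The gaps are tied to actual losses, hence at most 1, only if there is a round; for T = 0 the
  -- regret sum is empty.
  rcases Nat.eq_zero_or_pos T with rfl | hT
  · simp only [Finset.range_zero, Finset.sum_empty]
    positivity
  refine h.regret_le hc hK hs hD0 ((hD k₁ hk₁).trans ?_) hD
  rw [← hs.integral_sub_eq hT]
  have hle : ∀ ω, ‖ℓ 0 ω k₁ - ℓ 0 ω best‖ ≤ 1 := fun ω => by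
    have h1 := hs.loss_mem 0 hT ω k₁
    have h2 := hs.loss_mem 0 hT ω best
    exact abs_le.2 ⟨by linarith [h1.1, h2.2], by linarith [h1.2, h2.1]⟩
  have := norm_integral_le_of_norm_le_const (μ := μ) (ae_of_all _ hle)
  rw [probReal_univ, mul_one] at this
  exact (le_abs_self _).trans this
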